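/- Let $\mathbb K$ be an infinite field with algebraic closure $\overline{\mathbb K}$ and let $m,p\ge 1$, $q\ge 0$ be integers. Let $\mathcal C^q_{m,p}$ be the set of all $\alpha^{(a)}$ with $\alpha=(\alpha_1<\dots<\alpha_p)$ in $\{1,\dots,m+p\}$ and $0\le a\le q$, ordered by $$\alpha^{(a)}\le\beta^{(b)}\iff a\le b\ \text{ and }\ \alpha_i\le\beta_{b-a+i}\ \text{ for } i=1,\dots,p-b+a,$$ and put $|\alpha^{(a)}|=a(m+p)+\sum_i(\alpha_i-i)$. Let $z_{\alpha^{(a)}}$, $\alpha^{(a)}\in\mathcal C^q_{m,p}$, be the coordinates of the projective space $\mathbb P=\mathbb P(\bigwedge^p\mathbb K^{m+p}\otimes\mathbb K^{q+1})$ over $\mathbb K$. A degree $q$ map $M\colon\mathbb P^1\to \mathrm{Grass}(p,\overline{\mathbb K}^{m+p})$, represented by an $(m+p)\times p$ matrix $M(t)$ of polynomials that has rank $p$ for every $t\in\overline{\mathbb K}$ and whose maximal minors $M_\alpha(t)$ have maximal degree $q$, defines a point of $\mathbb P$ with $z_{\alpha^{(a)}}$ equal to the coefficient of $t^a$ in $M_\alpha(t)$.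 Let the quantum Grassmannian $\mathcal K^q_{m,p}\subset\mathbb P$ be the Zariski closure (over $\mathbb K$) of the set of these points, that is, the zero locus of all forms over $\mathbb K$ that vanish at all of them, and let $$Z_{\alpha^{(a)}}=\{z\in\mathcal K^q_{m,p}\mid z_{\beta^{(b)}}=0 \text{ whenever } \beta^{(b)}\not\le\alpha^{(a)}\}.$$ Let $L\subset\mathbb K^{m+p}$ be an $m$-plane with no vanishing Plücker coordinates, i.e. the column space of an $(m+p)\times m$ matrix, also written $L$, none of whose $m\times m$ minors vanishes. Let $L_\alpha$ be the signed complementary minor of $L$ that is the coefficient of $M_\alpha$ in the expansion of $\det[M:L]$ along the columns of an $(m+p)\times p$ matrix $M$. For $s\in\mathbb K$, let $\mathcal H(s,L)\subset\mathbb P$ be the hyperplane $$\sum_{\alpha^{(a)}\in\mathcal C^q_{m,p}} z_{\alpha^{(a)}}\,L_\alpha\,s^{|\alpha^{(a)}|}=0 .$$ (For $s\neq0$, a degree $q$ map $M$ lies on it exactly when $M(s^{m+p})\cap s.L\ne\{0\}$, where $s.\mathbf e_i=s^{m+p-i}\mathbf e_i$.) Then for all $k\ge 0$, all distinct $s_1,\dots,s_k\in\mathbb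 K$ and every $\alpha^{(a)}\in\mathcal C^q_{m,p}$, the intersection $$Z_{\alpha^{(a)}}\cap\mathcal H(s_1,L)\cap\dots\cap\mathcal H(s_k,L)$$ has Krull dimension exactly $|\alpha^{(a)}|-k$ if $k\le|\alpha^{(a)}|$, and is empty (as a subset of the scheme $\mathbb P$) if $k>|\alpha^{(a)}|$. -/

import Mathlib

open Polynomial

attribute [local instance] MvPolynomial.gradedAlgebra

/-- Indices `α^(a)` of the quantum Plücker coordinates: an increasing sequence
`α₁ < ⋯ < α_p` in `{1, …, m+p}` (written here with entries in `{0, …, m+p-1}`) together with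
an integer `0 ≤ a ≤ q`. -/
@[ext]
structure QuantumIndex (m p q : ℕ) where
  /-- the increasing sequence -/
  seq : Fin p ↪o Fin (m + p)
  /-- the exponent -/
  exp : Fin (q + 1)

namespace QuantumIndex

variable {m p q : ℕ}

noncomputable instance : Fintype (QuantumIndex m p q) :=
  Fintype.ofInjective
    (fun x => ((fun i => x.seq i, x.exp) : (Fin p → Fin (m + p)) × Fin (q + 1)))
    (fun x y h => by
      obtain ⟨h₁, h₂⟩ := Prod.mk.inj h
      exact QuantumIndex.ext (DFunLike.coe_injective h₁) h₂)

/-- `α^(a) ≤ β^(b)` iff `a ≤ b` and `α_i ≤ β_{b-a+i}` whenever both indices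
lie in the range `1, …, p`. -/
instance : LE (QuantumIndex m p q) where
  le x y := x.exp ≤ y.exp ∧
    ∀ i j : Fin p, (j : ℕ) = ((y.exp : ℕ) - (x.exp : ℕ)) + (i : ℕ) → x.seq i ≤ y.seq j

/-- The rank `|α^(a)| = a (m + p) + ∑ i, (α_i - i)`. As `α` is increasing, `α_i ≥ i`, so that
the subtraction of natural numbers does not truncate. -/
def rank (x : QuantumIndex m p q) : ℕ :=
  (x.exp : ℕ) * (m + p) + ∑ i : Fin p, ((x.seq i : ℕ) - (i : ℕ))

end QuantumIndex

/-- The Plücker space `ℙ(⋀^p K^(m+p) ⊗ K^(q+1))`, as the projective spectrum of the polynomial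
ring in the quantum Plücker coordinates `z_{α^(a)}`, with its Zariski topology. -/
abbrev PluckerSpace (K : Type*) [Field K] (m p q : ℕ) : Type _ :=
  ProjectiveSpectrum (MvPolynomial.homogeneousSubmodule (QuantumIndex m p q) K)

/-- The maximal minor `M_α` of an `(m+p) × p` matrix `M`, in the rows listed by `α`. -/
noncomputable def maximalMinor {R : Type*} [CommRing R] {m p : ℕ} (M : Matrix (Fin (m + p)) (Fin p) R)
    (α : Fin p ↪o Fin (m + p)) : R :=
  (M.submatrix α id).det

/-- Over an algebraically closed field `F`, the polynomial matrix `M(t)` represents a degree `q`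
map `ℙ¹ → Grass(p, F^(m+p))`, `t ↦ column space of M(t)`: at each `t ∈ F` some maximal minor
of `M(t)` is nonzero (so `M(t)` has rank `p`), and the maximal minors are polynomials whose
maximal degree is `q`. -/
structure RepresentsCurve {F : Type*} [Field F] {m p : ℕ} (q : ℕ)
    (M : Matrix (Fin (m + p)) (Fin p) F[X]) : Prop where
  rank_eq : ∀ t : F, ∃ α, (maximalMinor M α).eval t ≠ 0
  natDegree_le : ∀ α, (maximalMinor M α).natDegree ≤ q
  coeff_ne_zero : ∃ α, (maximalMinor M α).coeff q ≠ 0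

/-- The quantum Plücker coordinates of `M`: the coefficient of `t^a` in `M_α(t)`. -/
noncomputable def quantumPlucker {F : Type*} [Field F] {m p : ℕ} (q : ℕ)
    (M : Matrix (Fin (m + p)) (Fin p) F[X]) (x : QuantumIndex m p q) : F :=
  (maximalMinor M x.seq).coeff x.exp

/-- The quantum Grassmannian: the Zariski closure in Plücker space of the image of the space of
degree `q` maps `ℙ¹ → Grass(p, K^(m+p))` under the Plücker map, that is, the zero locus of all
forms over `K` that vanish at the quantum Plücker coordinates of every such map defined over the
algebraic closure of `K`. -/
noncomputable def quantumGrassmannian (K : Type*) [Field K] (m p q : ℕ) : Set (PluckerSpace K m p q) :=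
  ProjectiveSpectrum.zeroLocus _
    {f | (∃ d, f.IsHomogeneous d) ∧
      ∀ M : Matrix (Fin (m + p)) (Fin p) (AlgebraicClosure K)[X],
        RepresentsCurve q M → MvPolynomial.aeval (quantumPlucker q M) f = 0}

/-- The quantum Schubert variety `Z_{α^(a)}`: the points `z` of the quantum Grassmannian with
`z_{β^(b)} = 0` for all `β^(b) ≰ α^(a)`. -/
def quantumSchubert (K : Type*) [Field K] {m p q : ℕ} (x : QuantumIndex m p q) :
    Set (PluckerSpace K m p q) :=
  quantumGrassmannian K m p q ∩
    ProjectiveSpectrum.zeroLocus _ {f | ∃ y : QuantumIndex m p q, ¬ y ≤ x ∧ f = MvPolynomial.X y}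

/-- The signed complementary maximal minor `L_α` of an `(m+p) × m` matrix `L`, which is the
coefficient of `M_α` in the expansion of `det [M : L]` along the columns of `M`: the determinant
of the matrix whose first `p` columns are the unit vectors `e_{α_1}, …, e_{α_p}` and whose last
`m` columns are those of `L`. -/
def complementaryMinor {K : Type*} [Field K] {m p : ℕ} (L : Matrix (Fin (m + p)) (Fin m) K)
    (α : Fin p ↪o Fin (m + p)) : K :=
  ((Matrix.of fun (i : Fin (m + p)) (j : Fin p ⊕ Fin m) =>
    Sum.elim (fun a : Fin p => if i = α a then (1 : K) else 0) (fun b : Fin m => L i b) j).submatrix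
      id (fun i : Fin (m + p) => finSumFinEquiv.symm (Fin.cast (Nat.add_comm m p) i))).det

/-- The linear form `Φ(s, L) = ∑ z_{α^(a)} L_α s^|α^(a)|`. For a matrix `M` representing a
degree `q` map and `s ≠ 0`, the number `s ^ (m choose 2) * Φ(s, L)` at the quantum Plücker
coordinates of `M` is `det [M(s^(m+p)) : s.L]`, where `s.e_i = s^(m+p-i) e_i`. -/
noncomputable def hyperplaneForm {K : Type*} [Field K] {m p : ℕ} (q : ℕ)
    (L : Matrix (Fin (m + p)) (Fin m) K) (s : K) : MvPolynomial (QuantumIndex m p q) K :=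
  ∑ x : QuantumIndex m p q,
    MvPolynomial.C (complementaryMinor L x.seq * s ^ x.rank) * MvPolynomial.X x

/-- The hyperplane `H(s, L)` in Plücker space defined by `Φ(s, L) = 0`; it meets the space of
degree `q` maps `M`, for `s ≠ 0`, in the maps with `M(s^(m+p)) ∩ s.L ≠ {0}`, where `L` also
denotes the column space of the matrix. -/
def hyperplane {K : Type*} [Field K] {m p : ℕ} (q : ℕ)
    (L : Matrix (Fin (m + p)) (Fin m) K) (s : K) : Set (PluckerSpace K m p q) :=
  ProjectiveSpectrum.zeroLocus _ {hyperplaneForm q L s}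

/-!
The proof combines a bound from above on the number of hyperplanes through a point with an
explicit chain of families of curves.

*Emptiness.* Let `z` be a point of `Z_{α^(a)}`. As a polynomial in `s`, the form `Φ(s, L)`
evaluated at `z` has degree at most `|α^(a)|`, so if it vanishes for more than `|α^(a)|` values of
`s`, all its coefficients `∑_{|β^(b)| = r} z_{β^(b)} L_β` vanish. For the largest rank `r` that
occurs in the support of `z` this sum has just one nonzero term (`X_mul_X_mem_of_weight_eq`), and
`L_β ≠ 0`: a contradiction. Uniqueness of the term follows from the Plücker relations: exchanging
an entry `α_i` with an entry `β_j ≠ α_i` changes the rank by a number that is nonzero modulo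
`m + p`, so in the relation for two coordinates of the largest rank all exchanged products contain a
coordinate of larger rank, which vanishes. This is `quantumSchubert_inter_hyperplane_eq_empty`.

*Upper bound.* As `K` is infinite, the given hyperplanes can be completed to `|α^(a)| + 1`
hyperplanes without a common point on `Z_{α^(a)}`. Linear forms without a common zero on a
projective scheme generate a subring over which its homogeneous coordinate ring is integral
(`MvPolynomial.isIntegral_of_zeroLocus_eq_empty`). Hence `r` hyperplanes without a common point on
a projective set bound its dimension by `r - 1`
(`MvPolynomial.topologicalKrullDim_lt_of_inter_eq_empty`).

*Lower bound.* The generic `(m+p) × p` matrix whose `j`-th column, read as a polynomial in `s`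
with `s^(m+p) = t`, has degree at most `J j` defines a homogeneous prime `familyIdeal K m q J`.
Its dimension is at least `∑ j, (J j - j) + 1` in affine space, since the numbers `J j` can be
lowered one unit at a time, with a strictly smaller family each time (`le_coheight_familyIdeal`).
For the window `J` of the periodic extension of `α` that starts at `a`, that number is
`|α^(a)| + 1`, and the family lies in `Z_{α^(a)}` (`zeroLocus_familyIdeal_subset_quantumSchubert`),
because it is a limit of curves of degree `q`. So the `|α^(a)| + 1` linear forms are algebraically
independent modulo this prime, and going up along a chain of coordinate subspaces gives a chain of
homogeneous primes of length `|α^(a)| - k` in the intersection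
(`MvPolynomial.le_topologicalKrullDim_of_zeroLocus_eq_empty`).
-/

/-! ### Forms without a common zero and integrality -/

namespace MvPolynomial

variable {σ ι K : Type*} [Field K]

theorem coe_decompose_eq_homogeneousComponent (f : MvPolynomial σ K) (d : ℕ) :
    (DirectSum.decompose (homogeneousSubmodule σ K) f d : MvPolynomial σ K) =
      homogeneousComponent d f :=
  decomposition.decompose'_apply f d

theorem homogeneousComponent_mul_of_isHomogeneous_one {g h : MvPolynomial σ K}
    (hh : h.IsHomogeneous 1) {d : ℕ} (hd : 1 ≤ d) :
    homogeneousComponent d (g * h) = homogeneousComponent (d - 1) g * h := by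
  have := DirectSum.coe_decompose_mul_of_right_mem_of_le (homogeneousSubmodule σ K) (a := g)
    (b := h) (i := 1) (n := d) ((mem_homogeneousSubmodule _ _).2 hh) hd
  simpa only [coe_decompose_eq_homogeneousComponent] using this

theorem isHomogeneous_sup_span {I : Ideal (MvPolynomial σ K)}
    (hI : I.IsHomogeneous (homogeneousSubmodule σ K)) {h : ι → MvPolynomial σ K}
    (hh : ∀ i, (h i).IsHomogeneous 1) :
    (I ⊔ Ideal.span (Set.range h)).IsHomogeneous (homogeneousSubmodule σ K) := by
  refine hI.sup (Ideal.homogeneous_span _ _ ?_)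
  rintro _ ⟨i, rfl⟩
  exact ⟨1, (mem_homogeneousSubmodule _ _).2 (hh i)⟩

theorem X_mem_irrelevant (x : σ) :
    (X x : MvPolynomial σ K) ∈ HomogeneousIdeal.irrelevant (homogeneousSubmodule σ K) :=
  HomogeneousIdeal.mem_irrelevant_of_mem _ one_pos
    ((mem_homogeneousSubmodule _ _).2 (isHomogeneous_X K x))

/-- The projective Nullstellensatz for an empty zero locus. -/
theorem X_mem_radical_of_zeroLocus_eq_empty {J : Ideal (MvPolynomial σ K)}
    (hJ : J.IsHomogeneous (homogeneousSubmodule σ K))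
    (hempty : ProjectiveSpectrum.zeroLocus (homogeneousSubmodule σ K) (J : Set _) = ∅) (x : σ) :
    X x ∈ J.radical := by
  rw [Ideal.radical_eq_sInf, Ideal.mem_sInf]
  rintro 𝔭 ⟨hJ𝔭, h𝔭⟩
  by_contra hx
  have hcore := Ideal.toIdeal_homogeneousCore_le (homogeneousSubmodule σ K) 𝔭
  have hrel : ¬ HomogeneousIdeal.irrelevant (homogeneousSubmodule σ K) ≤
      𝔭.homogeneousCore (homogeneousSubmodule σ K) := fun h => hx (hcore (h (X_mem_irrelevant x)))
  have hmem : (⟨𝔭.homogeneousCore (homogeneousSubmodule σ K), h𝔭.homogeneousCore, hrel⟩ :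
      ProjectiveSpectrum (homogeneousSubmodule σ K)) ∈
        ProjectiveSpectrum.zeroLocus (homogeneousSubmodule σ K) (J : Set _) := by
    rw [ProjectiveSpectrum.mem_zeroLocus]
    have h1 := Ideal.homogeneousCore_mono (homogeneousSubmodule σ K) hJ𝔭
    have h2 := hJ.toIdeal_homogeneousCore_eq_self
    intro f hf
    rw [← h2] at hf
    exact h1 hf
  rw [hempty] at hmem
  exact hmem

/-- An ideal containing a power of each variable contains all forms of large degree. -/
theorem exists_forall_isHomogeneous_mem [Finite σ] {J : Ideal (MvPolynomial σ K)}
    (hJ : ∀ x, X x ∈ J.radical) :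
    ∃ D, ∀ d, D ≤ d → ∀ f : MvPolynomial σ K, f.IsHomogeneous d → f ∈ J := by
  classical
  have := Fintype.ofFinite σ
  choose N hN using fun x => Ideal.mem_radical_iff.1 (hJ x)
  refine ⟨∑ x, N x + 1, fun d hd f hf => ?_⟩
  rw [f.as_sum]
  refine Ideal.sum_mem _ fun s hs => ?_
  have hdeg : ∑ x, s x = d := by
    rw [← Finsupp.degree_eq_sum, hf.degree_eq_sum_deg_support hs]; rfl
  obtain ⟨x, hx⟩ : ∃ x, N x ≤ s x := by
    by_contra! h
    have := Finset.sum_le_sum (s := Finset.univ) fun x _ => (h x).le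
    omega
  have : monomial s (coeff s f) =
      monomial (s - Finsupp.single x (N x)) (coeff s f) * X x ^ N x := by
    rw [X_pow_eq_monomial, monomial_mul, mul_one, tsub_add_cancel_of_le]
    simpa using hx
  rw [this]
  exact Ideal.mul_mem_left _ _ (hN x)

/-- Noether normalization for linear forms without a common zero: the homogeneous coordinate ring
of a projective scheme is integral over the subring generated by linear forms that have no common
zero on it. -/
theorem isIntegral_of_zeroLocus_eq_empty [Finite σ] [Finite ι] {I : Ideal (MvPolynomial σ K)}
    (hI : I.IsHomogeneous (homogeneousSubmodule σ K)) {h : ι → MvPolynomial σ K}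
    (hh : ∀ i, (h i).IsHomogeneous 1)
    (hempty : ProjectiveSpectrum.zeroLocus (homogeneousSubmodule σ K)
      ((I : Set (MvPolynomial σ K)) ∪ Set.range h) = ∅) :
    ((Ideal.Quotient.mk I).comp (aeval (R := K) h : MvPolynomial ι K →ₐ[K] _).toRingHom
      ).IsIntegral := by
  classical
  have := Fintype.ofFinite ι
  have hJ : ProjectiveSpectrum.zeroLocus (homogeneousSubmodule σ K)
      ((I ⊔ Ideal.span (Set.range h) : Ideal (MvPolynomial σ K)) : Set _) = ∅ := by
    rw [ProjectiveSpectrum.zeroLocus_sup_ideal, ProjectiveSpectrum.zeroLocus_span,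
      ← ProjectiveSpectrum.zeroLocus_union, hempty]
  obtain ⟨D, hD⟩ := exists_forall_isHomogeneous_mem
    (X_mem_radical_of_zeroLocus_eq_empty (isHomogeneous_sup_span hI hh) hJ)
  set φ : MvPolynomial ι K →+* MvPolynomial σ K ⧸ I :=
    (Ideal.Quotient.mk I).comp (aeval (R := K) h : MvPolynomial ι K →ₐ[K] _).toRingHom with hφ
  let : Algebra (MvPolynomial ι K) (MvPolynomial σ K ⧸ I) := φ.toAlgebra
  let : Module (MvPolynomial ι K) (MvPolynomial σ K ⧸ I) := Algebra.toModule
  have hsmul : ∀ (a : MvPolynomial ι K) (b : MvPolynomial σ K),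
      a • (Ideal.Quotient.mk I b) = Ideal.Quotient.mk I (aeval h a * b) := fun a b => by
    rw [Algebra.smul_def, map_mul]; rfl
  -- the module generated by the monomials of degree at most `D`
  let M : Submodule (MvPolynomial ι K) (MvPolynomial σ K ⧸ I) :=
    Submodule.span _ ((fun s : σ →₀ ℕ => Ideal.Quotient.mk I (monomial s 1)) '' {s | s.degree ≤ D})
  have hform : ∀ d, ∀ f : MvPolynomial σ K, f.IsHomogeneous d → Ideal.Quotient.mk I f ∈ M := by
    intro d
    induction d using Nat.strong_induction_on with
    | _ d ih =>
      intro f hf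
      rcases le_or_gt d D with hdD | hdD
      · rw [f.as_sum, map_sum]
        refine Submodule.sum_mem _ fun s hs => ?_
        have : Ideal.Quotient.mk I (monomial s (coeff s f)) =
            (C (coeff s f) : MvPolynomial ι K) • Ideal.Quotient.mk I (monomial s 1) := by
          rw [hsmul, aeval_C, algebraMap_eq, C_mul_monomial, mul_one]
        rw [this]
        refine Submodule.smul_mem _ _ (Submodule.subset_span ⟨s, ?_, rfl⟩)
        exact (hf.degree_eq_sum_deg_support hs).symm.trans_le hdD
      · obtain ⟨a, ha, b, hb, hab⟩ := Submodule.mem_sup.1 (hD d hdD.le f hf)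
        obtain ⟨c, hc⟩ := (Ideal.mem_span_range_iff_exists_fun).1 hb
        have hd1 : 1 ≤ d := by omega
        have key : f = homogeneousComponent d a +
            ∑ i, homogeneousComponent (d - 1) (c i) * h i := by
          rw [← homogeneousComponent_eq_self hf, ← hab, ← hc, map_add, map_sum]
          simp_rw [homogeneousComponent_mul_of_isHomogeneous_one (hh _) hd1]
        rw [key, map_add, Ideal.Quotient.eq_zero_iff_mem.2
          (homogeneousComponent_mem_of_mem hI ha d), zero_add, map_sum]
        refine Submodule.sum_mem _ fun i _ => ?_
        have : Ideal.Quotient.mk I (homogeneousComponent (d - 1) (c i) * h i) =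
            (X i : MvPolynomial ι K) •
              Ideal.Quotient.mk I (homogeneousComponent (d - 1) (c i)) := by
          rw [hsmul, aeval_X, mul_comm]
        rw [this]
        exact Submodule.smul_mem _ _ (ih _ (by omega) _ (homogeneousComponent_isHomogeneous _ _))
  have htop : M = ⊤ := by
    rw [eq_top_iff]
    rintro y -
    obtain ⟨f, rfl⟩ := Ideal.Quotient.mk_surjective y
    rw [← sum_homogeneousComponent f, map_sum]
    exact Submodule.sum_mem _ fun d _ => hform d _ (homogeneousComponent_isHomogeneous _ _)
  have hfin : Module.Finite (MvPolynomial ι K) (MvPolynomial σ K ⧸ I) :=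
    ⟨htop ▸ Submodule.fg_span ((Finsupp.finite_of_degree_le D).image _)⟩
  exact fun x => Algebra.IsIntegral.isIntegral (R := MvPolynomial ι K) x

end MvPolynomial

/-! ### Dimension of projective sets -/

section IntegralModPrime

variable {B R : Type*} [CommRing B] [CommRing R] {φ : B →+* R} {Q : Ideal R}

/-- Incomparability for a ring homomorphism `B → R` that is integral modulo `Q`. -/
theorem Ideal.comap_lt_comap_of_isIntegral_quotient
    (hφ : ((Ideal.Quotient.mk Q).comp φ).IsIntegral) {I J : Ideal R} [I.IsPrime] (hQI : Q ≤ I)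
    (hIJ : I < J) : I.comap φ < J.comap φ := by
  obtain ⟨hle, x, hxJ, hxI⟩ := SetLike.lt_iff_le_and_exists.1 hIJ
  obtain ⟨p, hp, hpx⟩ := hφ (Ideal.Quotient.mk Q x)
  refine Ideal.comap_lt_comap_of_root_mem_sdiff hle ⟨hxJ, hxI⟩ (p := p)
    (Polynomial.map_monic_ne_zero hp) (hQI ?_)
  rw [← Ideal.Quotient.eq_zero_iff_mem, Polynomial.hom_eval₂]
  exact hpx

/-- Going up for a ring homomorphism `B → R` that is integral modulo `Q`. -/
theorem Ideal.exists_ideal_over_prime_of_isIntegral_quotient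
    (hφ : ((Ideal.Quotient.mk Q).comp φ).IsIntegral) {I : Ideal R} [I.IsPrime] (hQI : Q ≤ I)
    {p : Ideal B} [p.IsPrime] (hIp : I.comap φ ≤ p) :
    ∃ J ≥ I, J.IsPrime ∧ J.comap φ = p := by
  let : Algebra B (R ⧸ Q) := ((Ideal.Quotient.mk Q).comp φ).toAlgebra
  have : Algebra.IsIntegral B (R ⧸ Q) := ⟨hφ⟩
  have hker : RingHom.ker (Ideal.Quotient.mk Q) ≤ I := by rwa [Ideal.mk_ker]
  have hI' : (I.map (Ideal.Quotient.mk Q)).IsPrime :=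
    Ideal.map_isPrime_of_surjective Ideal.Quotient.mk_surjective hker
  have hIcomap : (I.map (Ideal.Quotient.mk Q)).comap (Ideal.Quotient.mk Q) = I := by
    rw [Ideal.comap_map_of_surjective _ Ideal.Quotient.mk_surjective, ← RingHom.ker_eq_comap_bot,
      sup_eq_left.2 hker]
  obtain ⟨J, hJ, hJp, hJc⟩ := Ideal.exists_ideal_over_prime_of_isIntegral_of_isPrime (S := R ⧸ Q) p
    (I.map (Ideal.Quotient.mk Q)) (by
      change Ideal.comap ((Ideal.Quotient.mk Q).comp φ) _ ≤ p
      rwa [← Ideal.comap_comap, hIcomap])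
  refine ⟨J.comap (Ideal.Quotient.mk Q), ?_, Ideal.comap_isPrime _ _, ?_⟩
  · rw [← hIcomap]
    exact Ideal.comap_mono hJ
  · rw [Ideal.comap_comap]
    exact hJc

theorem PrimeSpectrum.coheight_le_coheight_comap_of_isIntegral_quotient
    (hφ : ((Ideal.Quotient.mk Q).comp φ).IsIntegral) (n : ℕ) (x : PrimeSpectrum R)
    (hQ : Q ≤ x.asIdeal) (hn : (n : ℕ∞) ≤ Order.coheight x) :
    (n : ℕ∞) ≤ Order.coheight (PrimeSpectrum.comap φ x) := by
  induction n generalizing x with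
  | zero => simp
  | succ n ih =>
    obtain ⟨p, hp, hlen⟩ := Order.exists_series_of_le_coheight x hn
    have hlt : x < p ⟨1, by omega⟩ := by
      rw [← hp]
      exact p.strictMono (Fin.mk_lt_mk.2 one_pos)
    have hcoh : (n : ℕ∞) ≤ Order.coheight (p ⟨1, by omega⟩) := by
      refine le_trans ?_ (Order.rev_index_le_coheight p _)
      rw [Fin.val_rev]
      exact_mod_cast (by simp only [hlen]; omega)
    have h1 := ih (p ⟨1, by omega⟩) (hQ.trans hlt.le) hcoh
    have h2 : PrimeSpectrum.comap φ x < PrimeSpectrum.comap φ (p ⟨1, by omega⟩) :=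
      Ideal.comap_lt_comap_of_isIntegral_quotient hφ hQ hlt
    push_cast
    exact (add_le_add_left h1 1).trans (Order.coheight_add_one_le h2)

end IntegralModPrime

namespace ProjectiveSpectrum

section General

variable {A S : Type*} [CommRing A] [SetLike S A] [AddSubmonoidClass S A] {𝒜 : ℕ → S}
  [GradedRing 𝒜]

theorem isPrime_vanishingIdeal_of_isIrreducible {Z : Set (ProjectiveSpectrum 𝒜)}
    (hZ : IsIrreducible Z) : (vanishingIdeal Z).toIdeal.IsPrime := by
  obtain ⟨⟨x, hx⟩, hZ⟩ := hZ
  refine (vanishingIdeal Z).isHomogeneous.isPrime_of_homogeneous_mem_or_mem ?_ ?_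
  · intro htop
    refine x.isPrime.ne_top ((Ideal.eq_top_iff_one _).2 ?_)
    exact (mem_vanishingIdeal Z 1).1 (by
      change (1 : A) ∈ (vanishingIdeal Z).toIdeal; rw [htop]; trivial) x hx
  · intro f g _ _ hfg
    have hcover : Z ⊆ zeroLocus 𝒜 {f} ∪ zeroLocus 𝒜 {g} := fun y hy => by
      have := y.isPrime.mem_or_mem ((mem_vanishingIdeal Z _).1 hfg y hy)
      simpa [mem_zeroLocus] using this
    have hsub : ∀ a : A, Z ⊆ zeroLocus 𝒜 {a} → a ∈ (vanishingIdeal Z).toIdeal := fun a ha =>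
      (mem_vanishingIdeal Z a).2 fun y hy => by simpa [mem_zeroLocus] using ha hy
    rcases (isPreirreducible_iff_isClosed_union_isClosed.1 hZ) _ _ (isClosed_zeroLocus 𝒜 {f})
      (isClosed_zeroLocus 𝒜 {g}) hcover with h | h
    · exact Or.inl (hsub _ h)
    · exact Or.inr (hsub _ h)

theorem vanishingIdeal_image_lt_of_lt {T : Set (ProjectiveSpectrum 𝒜)}
    {C D : TopologicalSpace.IrreducibleCloseds T} (h : C < D) :
    (vanishingIdeal (Subtype.val '' (D : Set T))).toIdeal <
      (vanishingIdeal (Subtype.val '' (C : Set T))).toIdeal := by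
  have hsub : ∀ C : TopologicalSpace.IrreducibleCloseds T,
      (C : Set T) = Subtype.val ⁻¹' closure (Subtype.val '' (C : Set T)) := fun C => by
    rw [← Topology.IsInducing.subtypeVal.closure_eq_preimage_closure_image, C.isClosed.closure_eq]
  have hle : (C : Set T) ⊆ D := h.le
  refine lt_of_le_of_ne (vanishingIdeal_anti_mono (𝒜 := 𝒜) (Set.image_mono hle))
    fun heq => h.ne ?_
  refine TopologicalSpace.IrreducibleCloseds.ext ?_
  rw [hsub C, hsub D, ← zeroLocus_vanishingIdeal_eq_closure, ← zeroLocus_vanishingIdeal_eq_closure,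
    HomogeneousIdeal.toIdeal_injective heq]

/-- The dimension of a subspace of a projective spectrum is at least the length of any chain of
homogeneous primes in it. -/
theorem krullDim_le_topologicalKrullDim (T : Set (ProjectiveSpectrum 𝒜)) :
    Order.krullDim T ≤ topologicalKrullDim T := by
  rw [← Order.krullDim_orderDual]
  refine Order.krullDim_le_of_strictMono
    (fun x : Tᵒᵈ => (⟨closure {OrderDual.ofDual x}, isIrreducible_singleton.closure,
      isClosed_closure⟩ : TopologicalSpace.IrreducibleCloseds T)) ?_
  have hle : ∀ x y : T, y ∈ closure {x} ↔ x ≤ y := fun x y => by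
    rw [closure_subtype, Set.image_singleton, ← le_iff_mem_closure]
    rfl
  intro x y hxy
  have h' : OrderDual.ofDual y < OrderDual.ofDual x := hxy
  refine lt_of_le_not_ge ?_ fun h => ?_
  · exact closure_minimal (Set.singleton_subset_iff.2 ((hle _ _).2 h'.le)) isClosed_closure
  · exact h'.not_ge ((hle _ _).1 (h (subset_closure rfl)))

end General

end ProjectiveSpectrum

namespace MvPolynomial

open ProjectiveSpectrum

variable {σ K : Type*} [Field K]

theorem exists_X_notMem_asHomogeneousIdeal (x : ProjectiveSpectrum (homogeneousSubmodule σ K)) :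
    ∃ y, (X y : MvPolynomial σ K) ∉ x.asHomogeneousIdeal := by
  by_contra! hall
  refine x.not_irrelevant_le fun f hf => ?_
  change f ∈ x.asHomogeneousIdeal.toIdeal
  rw [f.as_sum]
  refine Ideal.sum_mem _ fun s hs => ?_
  have h0 : coeff 0 f = 0 := by
    have := (HomogeneousIdeal.mem_irrelevant_iff _ f).1 hf
    rw [GradedRing.proj_apply, coe_decompose_eq_homogeneousComponent, homogeneousComponent_zero]
      at this
    simpa using this
  have hs0 : s ≠ 0 := by
    rintro rfl
    exact (mem_support_iff.1 hs) h0
  obtain ⟨y, hy⟩ := Finsupp.ne_iff.1 hs0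
  have : monomial s (coeff s f) =
      monomial (s - Finsupp.single y 1) (coeff s f) * X y := by
    rw [X, monomial_mul, mul_one, tsub_add_cancel_of_le]
    simpa using Nat.one_le_iff_ne_zero.2 hy
  rw [this]
  exact Ideal.mul_mem_left _ _ (hall y)

/-- A relevant homogeneous prime is strictly contained in the ideal of polynomials without
constant term. -/
theorem asIdeal_lt_ker_constantCoeff (x : ProjectiveSpectrum (homogeneousSubmodule σ K)) :
    x.asHomogeneousIdeal.toIdeal < RingHom.ker (constantCoeff : MvPolynomial σ K →+* K) := by
  refine SetLike.lt_iff_le_and_exists.2 ⟨fun f hf => ?_, ?_⟩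
  · by_contra h0
    have h1 := homogeneousComponent_mem_of_mem x.asHomogeneousIdeal.isHomogeneous hf 0
    rw [homogeneousComponent_zero] at h1
    exact x.isPrime.ne_top (Ideal.eq_top_of_isUnit_mem _ h1
      ((Ne.isUnit (a := coeff 0 f) h0).map C))
  · obtain ⟨y, hy⟩ := exists_X_notMem_asHomogeneousIdeal x
    exact ⟨X y, by simp, hy⟩

theorem ringKrullDim_mvPolynomial_field (ι : Type*) [Finite ι] :
    ringKrullDim (MvPolynomial ι K) = Nat.card ι := by
  rw [MvPolynomial.ringKrullDim_of_isNoetherianRing, ringKrullDim_eq_zero_of_field, zero_add]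

theorem coheight_mvPolynomial_le {ι : Type*} [Finite ι] (x : PrimeSpectrum (MvPolynomial ι K)) :
    Order.coheight x ≤ Nat.card ι := by
  have := Order.coheight_le_krullDim x
  rw [← ringKrullDim, ringKrullDim_mvPolynomial_field] at this
  exact_mod_cast this

/-- A projective set without points on `r` hyperplanes has dimension less than `r`. -/
theorem topologicalKrullDim_lt_of_inter_eq_empty [Finite σ] {r : ℕ} (E : Set (MvPolynomial σ K))
    {h : Fin r → MvPolynomial σ K} (hh : ∀ i, (h i).IsHomogeneous 1)
    (hempty : ProjectiveSpectrum.zeroLocus (homogeneousSubmodule σ K) (E ∪ Set.range h) = ∅) :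
    topologicalKrullDim (ProjectiveSpectrum.zeroLocus (homogeneousSubmodule σ K) E) < r := by
  rw [topologicalKrullDim, Order.krullDim_lt_coe_iff]
  intro l
  let 𝔫 : Ideal (MvPolynomial σ K) := RingHom.ker (constantCoeff : MvPolynomial σ K →+* K)
  let I : TopologicalSpace.IrreducibleCloseds
      (ProjectiveSpectrum.zeroLocus (homogeneousSubmodule σ K) E) →
      HomogeneousIdeal (homogeneousSubmodule σ K) :=
    fun C => ProjectiveSpectrum.vanishingIdeal (Subtype.val ''
      (C : Set (ProjectiveSpectrum.zeroLocus (homogeneousSubmodule σ K) E)))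
  have hprime : ∀ C, (I C).toIdeal.IsPrime := fun C =>
    isPrime_vanishingIdeal_of_isIrreducible
      (C.isIrreducible.image _ continuous_subtype_val.continuousOn)
  have hE : E ⊆ I l.last := fun f hf => by
    refine (mem_vanishingIdeal _ _).2 ?_
    rintro _ ⟨x, -, rfl⟩
    exact x.2 hf
  have hint := isIntegral_of_zeroLocus_eq_empty (I l.last).isHomogeneous hh
    (Set.subset_eq_empty
      (ProjectiveSpectrum.zeroLocus_anti_mono _ (Set.union_subset_union_left _ hE)) hempty)
  have hge : ∀ i, (I l.last).toIdeal ≤ (I (l i)).toIdeal := fun i =>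
    have hle : (l i : Set (ProjectiveSpectrum.zeroLocus (homogeneousSubmodule σ K) E)) ⊆ l.last :=
      LTSeries.monotone l (Fin.le_last i)
    ProjectiveSpectrum.vanishingIdeal_anti_mono (𝒜 := homogeneousSubmodule σ K) (Set.image_mono hle)
  let c : TopologicalSpace.IrreducibleCloseds
      (ProjectiveSpectrum.zeroLocus (homogeneousSubmodule σ K) E) →
      PrimeSpectrum (MvPolynomial (Fin r) K) := fun C =>
    PrimeSpectrum.comap (aeval (R := K) h : MvPolynomial (Fin r) K →ₐ[K] _).toRingHom
      ⟨(I C).toIdeal, hprime C⟩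
  have hchain : ∀ n : ℕ, ∀ hn : n < l.length + 1,
      ((n + 1 : ℕ) : ℕ∞) ≤ Order.coheight (c (l ⟨n, hn⟩)) := by
    intro n
    induction n with
    | zero =>
      intro hn
      obtain ⟨x, hx⟩ := (l ⟨0, hn⟩).isIrreducible.nonempty
      have hlt : (I (l ⟨0, hn⟩)).toIdeal < 𝔫 :=
        lt_of_le_of_lt (fun f hf => (mem_vanishingIdeal _ f).1 hf _ ⟨x, hx, rfl⟩)
          (asIdeal_lt_ker_constantCoeff x.1)
      have hlt' : c (l ⟨0, hn⟩) < PrimeSpectrum.comap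
          (aeval (R := K) h : MvPolynomial (Fin r) K →ₐ[K] _).toRingHom
            ⟨𝔫, RingHom.ker_isPrime _⟩ :=
        have := hprime (l ⟨0, hn⟩)
        Ideal.comap_lt_comap_of_isIntegral_quotient hint (hge _) hlt
      refine le_trans ?_ (Order.coheight_add_one_le hlt')
      simp
    | succ n ih =>
      intro hn
      have hlt : l ⟨n, by omega⟩ < l ⟨n + 1, hn⟩ := l.strictMono (Fin.mk_lt_mk.2 (by omega))
      have hlt' : c (l ⟨n + 1, hn⟩) < c (l ⟨n, by omega⟩) :=
        have := hprime (l ⟨n + 1, hn⟩)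
        Ideal.comap_lt_comap_of_isIntegral_quotient hint (hge _) (vanishingIdeal_image_lt_of_lt hlt)
      refine le_trans ?_ (Order.coheight_add_one_le hlt')
      have := add_le_add_left (ih (by omega)) 1
      exact_mod_cast this
  have h1 := (hchain l.length (by omega)).trans (coheight_mvPolynomial_le _)
  rw [Nat.card_fin] at h1
  have : l.length + 1 ≤ r := by exact_mod_cast h1
  omega

/-- If the zero locus of a prime `P` in affine space has dimension at least `#ι`, then polynomials
indexed by `ι` over which the coordinate ring is integral are algebraically independent modulo
`P`. -/
theorem comap_aeval_eq_bot [Finite σ] {ι : Type*} [Finite ι] {P : Ideal (MvPolynomial σ K)}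
    (hP : P.IsPrime) {h : ι → MvPolynomial σ K}
    (hint : ((Ideal.Quotient.mk P).comp (aeval (R := K) h : MvPolynomial ι K →ₐ[K] _).toRingHom
      ).IsIntegral)
    (hdim : (Nat.card ι : ℕ∞) ≤ Order.coheight (⟨P, hP⟩ : PrimeSpectrum (MvPolynomial σ K))) :
    P.comap (aeval (R := K) h : MvPolynomial ι K →ₐ[K] _).toRingHom = ⊥ := by
  by_contra hne
  have h1 := PrimeSpectrum.coheight_le_coheight_comap_of_isIntegral_quotient hint _ ⟨P, hP⟩ le_rfl
    hdim
  have hlt : (⟨⊥, Ideal.isPrime_bot⟩ : PrimeSpectrum (MvPolynomial ι K)) <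
      PrimeSpectrum.comap (aeval (R := K) h : MvPolynomial ι K →ₐ[K] _).toRingHom ⟨P, hP⟩ :=
    (bot_lt_iff_ne_bot (a := P.comap (aeval (R := K) h : MvPolynomial ι K →ₐ[K] _).toRingHom)).2 hne
  have h2 := (add_le_add_left h1 1).trans
    ((Order.coheight_add_one_le hlt).trans (coheight_mvPolynomial_le _))
  have h3 : Nat.card ι + 1 ≤ Nat.card ι := by exact_mod_cast h2
  omega

/-- The prime ideal of the linear coordinate subspace where the variables `X (Sum.inl i)` and the
first `j` variables `X (Sum.inr i)` vanish. -/
noncomputable def coordIdeal (K : Type*) [Field K] (k r j : ℕ) :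
    Ideal (MvPolynomial (Fin k ⊕ Fin r) K) :=
  RingHom.ker (aeval (R := K) (Sum.elim 0 fun i : Fin r => if (i : ℕ) < j then 0 else
    X (Sum.inr i) : Fin k ⊕ Fin r → MvPolynomial (Fin k ⊕ Fin r) K))

instance isPrime_coordIdeal (k r j : ℕ) : (coordIdeal K k r j).IsPrime := RingHom.ker_isPrime _

theorem X_inl_mem_coordIdeal {k r : ℕ} (j : ℕ) (i : Fin k) :
    X (Sum.inl i) ∈ coordIdeal K k r j := by
  simp [coordIdeal]

theorem X_inr_mem_coordIdeal {k r j : ℕ} {i : Fin r} :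
    X (Sum.inr i) ∈ coordIdeal K k r j ↔ (i : ℕ) < j := by
  simp [coordIdeal, X_ne_zero]

theorem coordIdeal_mono (k r : ℕ) : Monotone (coordIdeal K k r) := by
  intro j j' hj f hf
  rw [coordIdeal, RingHom.mem_ker] at hf ⊢
  have key : (aeval (R := K) (Sum.elim 0 fun i : Fin r => if (i : ℕ) < j' then 0 else
      X (Sum.inr i) : Fin k ⊕ Fin r → MvPolynomial (Fin k ⊕ Fin r) K)).comp
      (aeval (R := K) (Sum.elim 0 fun i : Fin r => if (i : ℕ) < j then 0 else
        X (Sum.inr i) : Fin k ⊕ Fin r → MvPolynomial (Fin k ⊕ Fin r) K)) =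
      aeval (R := K) (Sum.elim 0 fun i : Fin r => if (i : ℕ) < j' then 0 else
        X (Sum.inr i) : Fin k ⊕ Fin r → MvPolynomial (Fin k ⊕ Fin r) K) := by
    refine algHom_ext fun i => ?_
    rcases i with i | i
    · simp
    · rcases lt_or_ge (i : ℕ) j with h | h
      · simp [h, h.trans_le hj]
      · simp [h.not_gt]
  rw [← key, AlgHom.comp_apply, hf, map_zero]

/-- If `k + (d + 1)` hyperplanes have no common point on an irreducible projective set of dimension
at least `k + d`, its intersection with the first `k` of them has dimension at least `d`. The chain
of primes lies over a chain of coordinate subspaces, by going up; its members can be taken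
homogeneous since those coordinate subspaces are cut out by the forms `h i`. -/
theorem le_topologicalKrullDim_of_zeroLocus_eq_empty [Finite σ] {k d : ℕ}
    {P : Ideal (MvPolynomial σ K)} (hPhom : P.IsHomogeneous (homogeneousSubmodule σ K))
    (hP : P.IsPrime) {h : Fin k ⊕ Fin (d + 1) → MvPolynomial σ K} (hh : ∀ i, (h i).IsHomogeneous 1)
    (hempty : ProjectiveSpectrum.zeroLocus (homogeneousSubmodule σ K)
      ((P : Set (MvPolynomial σ K)) ∪ Set.range h) = ∅)
    (hdim : ((k + (d + 1) : ℕ) : ℕ∞) ≤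
      Order.coheight (⟨P, hP⟩ : PrimeSpectrum (MvPolynomial σ K)))
    {T : Set (ProjectiveSpectrum (homogeneousSubmodule σ K))}
    (hT : ProjectiveSpectrum.zeroLocus (homogeneousSubmodule σ K)
      ((P : Set (MvPolynomial σ K)) ∪ Set.range (h ∘ Sum.inl)) ⊆ T) :
    (d : WithBot ℕ∞) ≤ topologicalKrullDim T := by
  have hint := isIntegral_of_zeroLocus_eq_empty hPhom hh hempty
  have hbot := comap_aeval_eq_bot hP hint (by simpa using hdim)
  set φ := (aeval (R := K) h : MvPolynomial (Fin k ⊕ Fin (d + 1)) K →ₐ[K] _).toRingHom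
  have hφX : ∀ i, φ (X i) = h i := fun i => aeval_X _ _
  refine le_trans ?_ (krullDim_le_topologicalKrullDim T)
  -- the homogeneous core of a prime over a coordinate ideal is a point of `T`
  have hpoint : ∀ j, j ≤ d → ∀ J : Ideal (MvPolynomial σ K), P ≤ J → J.IsPrime →
      J.comap φ = coordIdeal K k (d + 1) j →
      ∃ x : T, x.1.asHomogeneousIdeal = J.homogeneousCore (homogeneousSubmodule σ K) := by
    intro j hj J hPJ hJ hJφ
    have hcore := Ideal.toIdeal_homogeneousCore_le (homogeneousSubmodule σ K) J
    refine ⟨⟨⟨J.homogeneousCore _, hJ.homogeneousCore, fun hirr => ?_⟩, hT ?_⟩, rfl⟩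
    · have h1 : h (Sum.inr ⟨j, by omega⟩) ∈ J := hcore (hirr
        (HomogeneousIdeal.mem_irrelevant_of_mem _ one_pos
          ((mem_homogeneousSubmodule _ _).2 (hh _))))
      rw [← hφX, ← Ideal.mem_comap, hJφ, X_inr_mem_coordIdeal] at h1
      exact lt_irrefl _ h1
    · rw [mem_zeroLocus, Set.union_subset_iff]
      constructor
      · have h1 := Ideal.homogeneousCore_mono (homogeneousSubmodule σ K) hPJ
        have h2 := hPhom.toIdeal_homogeneousCore_eq_self
        intro f hf
        rw [← h2] at hf
        exact h1 hf
      · rintro _ ⟨i, rfl⟩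
        refine Ideal.mem_homogeneousCore_of_homogeneous_of_mem
          ⟨1, (mem_homogeneousSubmodule _ _).2 (hh _)⟩ ?_
        rw [Function.comp_apply, ← hφX, ← Ideal.mem_comap, hJφ]
        exact X_inl_mem_coordIdeal _ _
  have hchain : ∀ e, e ≤ d → ∀ J : Ideal (MvPolynomial σ K), P ≤ J → J.IsPrime →
      J.comap φ = coordIdeal K k (d + 1) (d - e) → ∀ x : T,
      x.1.asHomogeneousIdeal = J.homogeneousCore (homogeneousSubmodule σ K) →
      (e : ℕ∞) ≤ Order.coheight x := by
    intro e
    induction e with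
    | zero => intros; simp
    | succ e ih =>
      intro he J hPJ hJ hJφ x hx
      obtain ⟨J', hJJ', hJ', hJφ'⟩ := Ideal.exists_ideal_over_prime_of_isIntegral_quotient hint hPJ
        (p := coordIdeal K k (d + 1) (d - e)) (hJφ.trans_le (coordIdeal_mono _ _ (by omega)))
      obtain ⟨x', hx'⟩ := hpoint (d - e) (by omega) J' (hPJ.trans hJJ') hJ' hJφ'
      have hlt : x < x' := by
        change x.1.asHomogeneousIdeal < x'.1.asHomogeneousIdeal
        refine lt_of_le_not_ge ?_ fun hle => ?_
        · rw [hx, hx']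
          exact Ideal.homogeneousCore_mono _ hJJ'
        · have h1 : h (Sum.inr ⟨d - (e + 1), by omega⟩) ∈ x'.1.asHomogeneousIdeal := by
            rw [hx']
            refine Ideal.mem_homogeneousCore_of_homogeneous_of_mem
              ⟨1, (mem_homogeneousSubmodule _ _).2 (hh _)⟩ ?_
            rw [← hφX, ← Ideal.mem_comap, hJφ', X_inr_mem_coordIdeal]
            change d - (e + 1) < d - e
            omega
          have h2 := hle h1
          rw [hx] at h2
          have h3 := Ideal.toIdeal_homogeneousCore_le (homogeneousSubmodule σ K) J h2
          rw [← hφX, ← Ideal.mem_comap, hJφ, X_inr_mem_coordIdeal] at h3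
          exact lt_irrefl _ h3
      have h4 := add_le_add_left (ih (by omega) J' (hPJ.trans hJJ') hJ' hJφ' x' hx') 1
      push_cast
      exact h4.trans (Order.coheight_add_one_le hlt)
  obtain ⟨J, hPJ, hJ, hJφ⟩ := Ideal.exists_ideal_over_prime_of_isIntegral_quotient hint le_rfl
    (p := coordIdeal K k (d + 1) (d - d)) (hbot.trans_le bot_le)
  obtain ⟨x, hx⟩ := hpoint (d - d) (by omega) J hPJ hJ hJφ
  have h5 := hchain d le_rfl J hPJ hJ hJφ x hx
  have : ((d : ℕ∞) : WithBot ℕ∞) ≤ (Order.coheight x : WithBot ℕ∞) := by exact_mod_cast h5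
  exact this.trans (Order.coheight_le_krullDim x)

end MvPolynomial

/-! ### Plücker relations and the emptiness of large intersections -/

theorem Matrix.det_mul_det_eq_sum_updateRow {n R : Type*} [Fintype n] [DecidableEq n] [CommRing R]
    (A B : Matrix n n R) (i : n) :
    A.det * B.det = ∑ j, (A.updateRow i (B j)).det * (B.updateRow j (A i)).det := by
  have h1 : B.det • A i = ∑ j, (B.updateRow j (A i)).det • B j := by
    have h := Matrix.mulVec_cramer B.transpose (A i)
    rw [Matrix.det_transpose] at h
    rw [← h]
    ext c
    simp [Matrix.mulVec, dotProduct, Matrix.cramer_transpose_apply, mul_comm]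
  have h2 : (A.updateRow i (B.det • A i)).det = B.det * A.det := by
    rw [Matrix.det_updateRow_smul, Matrix.updateRow_eq_self]
  rw [mul_comm, ← h2, h1]
  have h3 := Matrix.detRowAlternating.toMultilinearMap.map_update_sum (m := A) Finset.univ i
    (fun j => (B.updateRow j (A i)).det • B j)
  refine h3.trans (Finset.sum_congr rfl fun j _ => ?_)
  exact (Matrix.det_updateRow_smul A i _ (B j)).trans (mul_comm _ _)

/-- The quadratic Plücker relation that exchanges the row `f i` of the minor `f` with each row of
the minor `g` in turn. -/
theorem Matrix.det_submatrix_mul_det_submatrix {n l R : Type*} [Fintype n] [DecidableEq n]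
    [CommRing R] (M : Matrix l n R) (f g : n → l) (i : n) :
    (M.submatrix f id).det * (M.submatrix g id).det =
      ∑ j, (M.submatrix (Function.update f i (g j)) id).det *
        (M.submatrix (Function.update g j (f i)) id).det := by
  have key : ∀ (f g : n → l) (i j : n), (M.submatrix f id).updateRow i (M.submatrix g id j) =
      M.submatrix (Function.update f i (g j)) id := fun f g i j => by
    ext a b
    by_cases h : a = i
    · subst h; simp
    · simp [h]
  simp_rw [Matrix.det_mul_det_eq_sum_updateRow (M.submatrix f id) (M.submatrix g id) i, key]

namespace QuantumIndex

variable {m p q : ℕ}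

/-- The rank of an index, shifted by the constant `∑ i, i`. -/
def weight (x : QuantumIndex m p q) : ℕ :=
  (x.exp : ℕ) * (m + p) + ∑ i : Fin p, (x.seq i : ℕ)

theorem val_le_seq (α : Fin p ↪o Fin (m + p)) (i : Fin p) : (i : ℕ) ≤ α i := by
  obtain ⟨i, hi⟩ := i
  induction i with
  | zero => simp
  | succ i ih =>
    have h1 := ih (by omega)
    have h2 : α ⟨i, by omega⟩ < α ⟨i + 1, hi⟩ := α.strictMono (Fin.mk_lt_mk.2 (by omega))
    have h3 : (α ⟨i, by omega⟩ : ℕ) < α ⟨i + 1, hi⟩ := h2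
    simp only at h1 ⊢
    omega

theorem rank_add_sum_eq_weight (x : QuantumIndex m p q) :
    x.rank + ∑ i : Fin p, (i : ℕ) = x.weight := by
  rw [rank, weight, add_assoc, ← Finset.sum_add_distrib]
  congr 1
  exact Finset.sum_congr rfl fun i _ => Nat.sub_add_cancel (val_le_seq _ _)

theorem rank_le_rank_of_le {x y : QuantumIndex m p q} (h : x ≤ y) : x.rank ≤ y.rank := by
  suffices h' : x.weight ≤ y.weight by
    have := rank_add_sum_eq_weight x
    have := rank_add_sum_eq_weight y
    omega
  obtain ⟨hexp, hseq⟩ := h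
  have hexp' : (x.exp : ℕ) ≤ y.exp := hexp
  obtain ⟨d, hd⟩ := Nat.exists_eq_add_of_le hexp'
  have hseq' : ∀ (i : Fin p) (h : d + i < p), (x.seq i : ℕ) ≤ y.seq ⟨d + i, h⟩ := fun i h =>
    hseq i ⟨d + i, h⟩ (by simp only; omega)
  have h1 : ∑ i : Fin p, (x.seq i : ℕ) ≤
      ∑ i : Fin p, ((if h : d + i < p then (y.seq ⟨d + i, h⟩ : ℕ) else 0) +
        if d + i < p then 0 else m + p) := by
    refine Finset.sum_le_sum fun i _ => ?_
    split_ifs with h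
    · simpa only [add_zero] using hseq' i h
    · simp
  have h2 : ∑ i : Fin p, (if h : d + i < p then (y.seq ⟨d + i, h⟩ : ℕ) else 0) ≤
      ∑ j : Fin p, (y.seq j : ℕ) := by
    classical
    rw [← Finset.sum_filter_add_sum_filter_not Finset.univ (fun i : Fin p => d + i < p)]
    rw [Finset.sum_eq_zero (s := Finset.univ.filter fun i : Fin p => ¬ d + i < p), add_zero]
    · have : ∀ i ∈ Finset.univ.filter (fun i : Fin p => d + i < p),
          (if h : d + i < p then (y.seq ⟨d + i, h⟩ : ℕ) else 0) =
            (fun j : Fin p => (y.seq j : ℕ)) (if h : d + i < p then ⟨d + i, h⟩ else i) := by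
        intro i hi
        simp [(Finset.mem_filter.1 hi).2]
      rw [Finset.sum_congr rfl this, ← Finset.sum_image (f := fun j : Fin p => (y.seq j : ℕ))
        (g := fun i : Fin p => if h : d + i < p then ⟨d + i, h⟩ else i)]
      · exact Finset.sum_le_sum_of_subset (Finset.subset_univ _)
      · intro i hi j hj hij
        have hi' := (Finset.mem_filter.1 (Finset.mem_coe.1 hi)).2
        have hj' := (Finset.mem_filter.1 (Finset.mem_coe.1 hj)).2
        simp only [hi', hj', dif_pos, Fin.mk.injEq] at hij
        exact Fin.ext (by omega)
    · intro i hi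
      simp [(Finset.mem_filter.1 hi).2]
  have h3 : ∑ i : Fin p, (if d + (i : ℕ) < p then 0 else m + p) ≤ d * (m + p) := by
    rw [← Finset.sum_filter_add_sum_filter_not Finset.univ (fun i : Fin p => d + i < p)]
    rw [Finset.sum_eq_zero (s := Finset.univ.filter fun i : Fin p => d + i < p), zero_add]
    · refine (Finset.sum_le_card_nsmul _ _ (m + p) fun i hi => ?_).trans ?_
      · split_ifs <;> omega
      · rw [smul_eq_mul]
        refine Nat.mul_le_mul_right _ ?_
        have hinj : Set.InjOn (fun i : Fin p => (p - 1 - i : ℕ))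
            (Finset.univ.filter fun i : Fin p => ¬ d + i < p) := by
          intro i _ j _ hij
          have := i.2
          have := j.2
          simp only at hij
          exact Fin.ext (by omega)
        have := Finset.card_le_card_of_injOn (t := Finset.range d) _ (fun i hi => ?_) hinj
        · simpa using this
        · have := (Finset.mem_filter.1 (Finset.mem_coe.1 hi)).2
          have := i.2
          simp only [Finset.coe_range, Set.mem_Iio]
          omega
    · intro i hi
      simp [(Finset.mem_filter.1 hi).2]
  rw [Finset.sum_add_distrib] at h1
  rw [weight, weight, hd, add_mul]
  omega

end QuantumIndex

section Plucker

variable {m p q : ℕ} {K : Type*} [Field K]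

/-- The increasing rearrangement of an injective map. -/
def sortedSeq (f : Fin p → Fin (m + p)) (hf : Function.Injective f) : Fin p ↪o Fin (m + p) :=
  OrderEmbedding.ofStrictMono (f ∘ Tuple.sort f)
    ((Tuple.monotone_sort f).strictMono_of_injective (hf.comp (Tuple.sort f).injective))

theorem sum_sortedSeq (f : Fin p → Fin (m + p)) (hf : Function.Injective f) :
    ∑ i, (sortedSeq f hf i : ℕ) = ∑ i, (f i : ℕ) :=
  Equiv.sum_comp (Tuple.sort f) fun i => (f i : ℕ)

theorem maximalMinor_sortedSeq {R : Type*} [CommRing R] (M : Matrix (Fin (m + p)) (Fin p) R)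
    (f : Fin p → Fin (m + p)) (hf : Function.Injective f) :
    (Equiv.Perm.sign (Tuple.sort f) : R) * maximalMinor M (sortedSeq f hf) =
      (M.submatrix f id).det := by
  have h : maximalMinor M (sortedSeq f hf) =
      (Equiv.Perm.sign (Tuple.sort f) : R) * (M.submatrix f id).det := by
    rw [← Matrix.det_permute]
    rfl
  rw [h, ← mul_assoc, ← Int.cast_mul, ← Units.val_mul, Int.units_mul_self, Units.val_one,
    Int.cast_one, one_mul]

variable (K) in
/-- The Plücker coordinate of an arbitrary sequence `f` of rows, as a polynomial in `t` whose
coefficients are quantum Plücker coordinates: it is alternating in `f`. -/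
noncomputable def pluckerPoly (q : ℕ) (f : Fin p → Fin (m + p)) :
    (MvPolynomial (QuantumIndex m p q) K)[X] :=
  open Classical in
  if hf : Function.Injective f then
    ∑ a : Fin (q + 1), monomial (a : ℕ)
      ((Equiv.Perm.sign (Tuple.sort f) : MvPolynomial (QuantumIndex m p q) K) *
        MvPolynomial.X ⟨sortedSeq f hf, a⟩)
  else 0

theorem coeff_pluckerPoly_eq_zero_or (f : Fin p → Fin (m + p)) (c : ℕ) :
    (pluckerPoly K q f).coeff c = 0 ∨ ∃ x : QuantumIndex m p q,
      x.weight = c * (m + p) + ∑ i, (f i : ℕ) ∧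
      ∃ ε : K, (pluckerPoly K q f).coeff c = MvPolynomial.C ε * MvPolynomial.X x := by
  classical
  rw [pluckerPoly]
  split_ifs with hf
  · by_cases hc : c < q + 1
    · refine Or.inr ⟨⟨sortedSeq f hf, ⟨c, hc⟩⟩, by simp [QuantumIndex.weight, sum_sortedSeq],
        ((Equiv.Perm.sign (Tuple.sort f) : ℤ) : K), ?_⟩
      rw [finsetSum_coeff, Finset.sum_eq_single ⟨c, hc⟩]
      · rw [coeff_monomial, if_pos rfl]
        simp
      · intro a _ ha
        rw [coeff_monomial, if_neg fun h => ha (Fin.ext h)]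
      · simp
    · refine Or.inl ?_
      rw [finsetSum_coeff]
      refine Finset.sum_eq_zero fun a _ => ?_
      rw [coeff_monomial, if_neg]
      have := a.2
      omega
  · simp

theorem isHomogeneous_coeff_pluckerPoly (f : Fin p → Fin (m + p)) (c : ℕ) :
    ((pluckerPoly K q f).coeff c).IsHomogeneous 1 := by
  rcases coeff_pluckerPoly_eq_zero_or (K := K) (q := q) f c with h | ⟨x, -, ε, h⟩
  · rw [h]; exact MvPolynomial.isHomogeneous_zero _ _ _
  · rw [h]; exact MvPolynomial.isHomogeneous_C_mul_X _ _

theorem coeff_pluckerPoly_orderEmbedding (x : QuantumIndex m p q) :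
    (pluckerPoly K q x.seq).coeff x.exp = MvPolynomial.X x := by
  have hsort : Tuple.sort x.seq = Equiv.refl _ :=
    Tuple.sort_eq_refl_iff_monotone.2 x.seq.monotone
  have hseq : sortedSeq x.seq x.seq.injective = x.seq := by
    ext i
    simp [sortedSeq, hsort]
  rw [pluckerPoly, dif_pos x.seq.injective, finsetSum_coeff, Finset.sum_eq_single x.exp]
  · rw [coeff_monomial, if_pos rfl, hsort, hseq]
    simp
  · intro a _ ha
    rw [coeff_monomial, if_neg fun h => ha (Fin.ext h)]
  · simp

theorem map_pluckerPoly {F : Type*} [Field F] [Algebra K F]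
    {M : Matrix (Fin (m + p)) (Fin p) F[X]} (hM : ∀ α, (maximalMinor M α).natDegree ≤ q)
    (f : Fin p → Fin (m + p)) :
    (pluckerPoly K q f).map (MvPolynomial.aeval (quantumPlucker q M)).toRingHom =
      (M.submatrix f id).det := by
  classical
  rw [pluckerPoly]
  split_ifs with hf
  · rw [← maximalMinor_sortedSeq M f hf,
      (maximalMinor M (sortedSeq f hf)).as_sum_range' (q + 1) (Nat.lt_succ_of_le (hM _)),
      ← Fin.sum_univ_eq_sum_range (fun a => monomial a ((maximalMinor M (sortedSeq f hf)).coeff a)),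
      Polynomial.map_sum, Finset.mul_sum]
    refine Finset.sum_congr rfl fun a _ => ?_
    rw [map_monomial, ← C_eq_intCast, C_mul_monomial]
    simp [quantumPlucker]
  · rw [Polynomial.map_zero, eq_comm]
    obtain ⟨i, j, hij, hne⟩ := by simpa [Function.Injective] using hf
    exact Matrix.det_zero_of_row_eq hne (by ext c; simp [hij])

theorem isHomogeneous_coeff_pluckerPoly_mul (f g : Fin p → Fin (m + p)) (c : ℕ) :
    ((pluckerPoly K q f * pluckerPoly K q g).coeff c).IsHomogeneous 2 := by
  rw [coeff_mul]
  exact MvPolynomial.IsHomogeneous.sum _ _ _ fun x _ =>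
    (isHomogeneous_coeff_pluckerPoly f _).mul (isHomogeneous_coeff_pluckerPoly g _)

/-- The Plücker relations hold on the quantum Grassmannian, as identities of polynomials in `t`. -/
theorem map_pluckerPoly_mul_map_pluckerPoly {z : PluckerSpace K m p q}
    (hz : z ∈ quantumGrassmannian K m p q) (f g : Fin p → Fin (m + p)) (i : Fin p) :
    (pluckerPoly K q f).map (Ideal.Quotient.mk z.asHomogeneousIdeal.toIdeal) *
        (pluckerPoly K q g).map (Ideal.Quotient.mk z.asHomogeneousIdeal.toIdeal) =
      ∑ j, (pluckerPoly K q (Function.update f i (g j))).map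
          (Ideal.Quotient.mk z.asHomogeneousIdeal.toIdeal) *
        (pluckerPoly K q (Function.update g j (f i))).map
          (Ideal.Quotient.mk z.asHomogeneousIdeal.toIdeal) := by
  simp_rw [← Polynomial.map_mul]
  rw [← Polynomial.map_sum, ← sub_eq_zero, ← Polynomial.map_sub]
  ext c
  rw [coeff_map, coeff_zero, Ideal.Quotient.eq_zero_iff_mem]
  refine hz ⟨⟨2, ?_⟩, fun M hM => ?_⟩
  · rw [coeff_sub, finsetSum_coeff]
    exact (isHomogeneous_coeff_pluckerPoly_mul _ _ _).sub
      (MvPolynomial.IsHomogeneous.sum _ _ _ fun j _ => isHomogeneous_coeff_pluckerPoly_mul _ _ _)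
  · have h := Matrix.det_submatrix_mul_det_submatrix M f g i
    simp_rw [← map_pluckerPoly (K := K) hM.natDegree_le, ← Polynomial.map_mul] at h
    rw [← Polynomial.map_sum, ← sub_eq_zero, ← Polynomial.map_sub] at h
    have := congrArg (fun P => P.coeff c) h
    simp only [coeff_map, coeff_zero] at this
    exact this

/-- On the quantum Grassmannian, at most one coordinate of the largest weight in the support of a
point is nonzero: in the Plücker relation for two such coordinates, every exchange changes the
weight modulo `m + p`, so that each product of exchanged coordinates contains one of weight larger
than `r`. -/
theorem X_mul_X_mem_of_weight_eq (hpos : 0 < m + p) {z : PluckerSpace K m p q}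
    (hz : z ∈ quantumGrassmannian K m p q) {r : ℕ}
    (hr : ∀ x : QuantumIndex m p q, r < x.weight → MvPolynomial.X x ∈ z.asHomogeneousIdeal)
    {x y : QuantumIndex m p q} (hx : x.weight = r) (hy : y.weight = r) (hxy : x ≠ y) :
    MvPolynomial.X x * MvPolynomial.X y ∈ z.asHomogeneousIdeal.toIdeal := by
  set mk := Ideal.Quotient.mk z.asHomogeneousIdeal.toIdeal with hmk
  have hvan : ∀ (f : Fin p → Fin (m + p)) (c : ℕ), r < c * (m + p) + ∑ i, (f i : ℕ) →
      ((pluckerPoly K q f).map mk).coeff c = 0 := by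
    intro f c hc
    rw [coeff_map, hmk, Ideal.Quotient.eq_zero_iff_mem]
    rcases coeff_pluckerPoly_eq_zero_or (K := K) (q := q) f c with h | ⟨x, hxw, ε, h⟩
    · rw [h]; exact Ideal.zero_mem _
    · rw [h]; exact Ideal.mul_mem_left _ _ (hr x (hxw ▸ hc))
  by_cases hsub : ∀ i, x.seq i ∈ Set.range y.seq
  · -- equal sequences and equal weights give equal exponents
    exfalso
    have hseq : x.seq = y.seq := by
      have hrange : Set.range x.seq = Set.range y.seq := by
        refine Set.eq_of_subset_of_ncard_le (Set.range_subset_iff.2 hsub) ?_ (Set.toFinite _)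
        rw [← Set.image_univ, ← Set.image_univ, Set.ncard_image_of_injective _ x.seq.injective,
          Set.ncard_image_of_injective _ y.seq.injective]
      exact OrderEmbedding.range_inj.1 hrange
    refine hxy (QuantumIndex.ext hseq (Fin.ext ?_))
    rw [← hy, QuantumIndex.weight, QuantumIndex.weight, hseq] at hx
    have h1 : (x.exp : ℕ) * (m + p) = y.exp * (m + p) := by omega
    exact Nat.eq_of_mul_eq_mul_right hpos h1
  · push Not at hsub
    obtain ⟨i, hi⟩ := hsub
    have h := congrArg (fun P => P.coeff ((x.exp : ℕ) + y.exp))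
      (map_pluckerPoly_mul_map_pluckerPoly hz x.seq y.seq i)
    simp only [finsetSum_coeff, ← hmk] at h
    rw [coeff_mul, Finset.sum_eq_single ((x.exp : ℕ), (y.exp : ℕ))] at h
    · rw [coeff_map, coeff_map, coeff_pluckerPoly_orderEmbedding,
        coeff_pluckerPoly_orderEmbedding, ← map_mul, Finset.sum_eq_zero] at h
      · exact Ideal.Quotient.eq_zero_iff_mem.1 h
      · intro j _
        rw [coeff_mul]
        refine Finset.sum_eq_zero fun cd hcd => ?_
        have hcd' : cd.1 + cd.2 = x.exp + y.exp := Finset.HasAntidiagonal.mem_antidiagonal.1 hcd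
        have hs1 : ∑ l, (Function.update x.seq i (y.seq j) l : ℕ) + x.seq i =
            ∑ l, (x.seq l : ℕ) + y.seq j := by
          have e1 := Finset.add_sum_erase Finset.univ (fun l => (x.seq l : ℕ)) (Finset.mem_univ i)
          have e2 := Finset.add_sum_erase Finset.univ
            (fun l => (Function.update x.seq i (y.seq j) l : ℕ)) (Finset.mem_univ i)
          have e3 : ∑ l ∈ Finset.univ.erase i, (Function.update x.seq i (y.seq j) l : ℕ) =
              ∑ l ∈ Finset.univ.erase i, (x.seq l : ℕ) :=
            Finset.sum_congr rfl fun l hl => by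
              rw [Function.update_of_ne (Finset.ne_of_mem_erase hl)]
          simp only [Function.update_self] at e1 e2
          omega
        have hs2 : ∑ l, (Function.update y.seq j (x.seq i) l : ℕ) + y.seq j =
            ∑ l, (y.seq l : ℕ) + x.seq i := by
          have e1 := Finset.add_sum_erase Finset.univ (fun l => (y.seq l : ℕ)) (Finset.mem_univ j)
          have e2 := Finset.add_sum_erase Finset.univ
            (fun l => (Function.update y.seq j (x.seq i) l : ℕ)) (Finset.mem_univ j)
          have e3 : ∑ l ∈ Finset.univ.erase j, (Function.update y.seq j (x.seq i) l : ℕ) =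
              ∑ l ∈ Finset.univ.erase j, (y.seq l : ℕ) :=
            Finset.sum_congr rfl fun l hl => by
              rw [Function.update_of_ne (Finset.ne_of_mem_erase hl)]
          simp only [Function.update_self] at e1 e2
          omega
        have hmul : cd.1 * (m + p) + cd.2 * (m + p) = x.exp * (m + p) + y.exp * (m + p) := by
          rw [← add_mul, hcd', add_mul]
        rw [QuantumIndex.weight] at hx hy
        have hne : cd.1 * (m + p) + ∑ l, (Function.update x.seq i (y.seq j) l : ℕ) ≠ r := by
          intro heq
          have h1 : cd.1 * (m + p) + y.seq j = x.exp * (m + p) + x.seq i := by omega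
          have h2 := congrArg (· % (m + p)) h1
          simp only [Nat.mul_add_mod_self_right, Nat.mod_eq_of_lt (y.seq j).2,
            Nat.mod_eq_of_lt (x.seq i).2] at h2
          exact hi ⟨j, Fin.ext h2⟩
        rcases lt_or_gt_of_ne hne with hlt | hgt
        · rw [hvan (Function.update y.seq j (x.seq i)) cd.2 (by omega), mul_zero]
        · rw [hvan (Function.update x.seq i (y.seq j)) cd.1 hgt, zero_mul]
    · intro cd hcd hne
      have hcd' : cd.1 + cd.2 = x.exp + y.exp := Finset.HasAntidiagonal.mem_antidiagonal.1 hcd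
      rw [QuantumIndex.weight] at hx hy
      rcases lt_trichotomy cd.1 (x.exp : ℕ) with hlt | heq | hgt
      · rw [hvan y.seq cd.2, mul_zero]
        have := Nat.mul_lt_mul_of_pos_right (show (y.exp : ℕ) < cd.2 by omega) hpos
        omega
      · exact absurd (Prod.ext heq (by simp only; omega)) hne
      · rw [hvan x.seq cd.1, zero_mul]
        have := Nat.mul_lt_mul_of_pos_right hgt hpos
        omega
    · simp

end Plucker

section Emptiness

variable {m p q : ℕ} {K : Type*} [Field K]

theorem complementaryMinor_ne_zero {L : Matrix (Fin (m + p)) (Fin m) K}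
    (hL : ∀ β : Fin m ↪o Fin (m + p), (L.submatrix β id).det ≠ 0) (α : Fin p ↪o Fin (m + p)) :
    complementaryMinor L α ≠ 0 := by
  classical
  intro h0
  rw [complementaryMinor] at h0
  obtain ⟨v, hv, hMv⟩ := Matrix.exists_mulVec_eq_zero_iff.2 h0
  set e : Fin (m + p) ≃ Fin p ⊕ Fin m := (finCongr (Nat.add_comm m p)).trans finSumFinEquiv.symm
  have hrow : ∀ i, (∑ a, (if i = α a then (1 : K) else 0) * v (e.symm (Sum.inl a))) +
      ∑ b, L i b * v (e.symm (Sum.inr b)) = 0 := by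
    intro i
    have h1 := congrFun hMv i
    rw [Matrix.mulVec, dotProduct, Pi.zero_apply, ← Equiv.sum_comp e.symm,
      Fintype.sum_sum_type] at h1
    refine Eq.trans ?_ h1
    congr 1 <;> refine Finset.sum_congr rfl fun a _ => ?_
    · have : finSumFinEquiv.symm (Fin.cast (Nat.add_comm m p) (e.symm (Sum.inl a))) =
        Sum.inl a := e.apply_symm_apply _
      simp [this]
    · have : finSumFinEquiv.symm (Fin.cast (Nat.add_comm m p) (e.symm (Sum.inr a))) =
        Sum.inr a := e.apply_symm_apply _
      simp [this]
  have hcard : (Finset.univ.image α)ᶜ.card = m := by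
    rw [Finset.card_compl, Finset.card_image_of_injective _ α.injective]
    simp
  set β := (Finset.univ.image α)ᶜ.orderEmbOfFin hcard
  have hβ : ∀ b a, β b ≠ α a := fun b a h => by
    have := Finset.orderEmbOfFin_mem _ hcard b
    rw [Finset.mem_compl] at this
    exact this (Finset.mem_image.2 ⟨a, Finset.mem_univ _, h.symm⟩)
  have hw : ∀ b, v (e.symm (Sum.inr b)) = 0 := by
    by_contra! hne
    obtain ⟨b, hb⟩ := hne
    refine hL β (Matrix.exists_mulVec_eq_zero_iff.1
      ⟨fun b => v (e.symm (Sum.inr b)), fun h => hb (congrFun h b), ?_⟩)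
    ext c
    have := hrow (β c)
    simp only [hβ, if_false, zero_mul, Finset.sum_const_zero, zero_add] at this
    exact this
  refine hv (funext fun i => ?_)
  obtain ⟨j, rfl⟩ := e.symm.surjective i
  rcases j with a | b
  · have := hrow (α a)
    simpa [hw, α.injective.eq_iff] using this
  · exact hw b

/-- A point of a quantum Schubert variety lies on at most `|α^(a)|` of the hyperplanes
`H(s, L)`: as a polynomial in `s`, the form `Φ(s, L)` has degree at most `|α^(a)|` at such a point,
and it is not zero, since one of its coefficients is a single nonzero term. -/
theorem quantumSchubert_inter_hyperplane_eq_empty {L : Matrix (Fin (m + p)) (Fin m) K}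
    (hp : 1 ≤ p) (hL : ∀ β : Fin m ↪o Fin (m + p), (L.submatrix β id).det ≠ 0)
    {ι : Type*} [Fintype ι] {s : ι → K} (hs : Function.Injective s) (α : QuantumIndex m p q)
    (hα : α.rank < Fintype.card ι) :
    quantumSchubert K α ∩ ⋂ i, hyperplane q L (s i) = ∅ := by
  classical
  rw [Set.eq_empty_iff_forall_notMem]
  rintro z ⟨⟨hz, hzα⟩, hzH⟩
  set Q := z.asHomogeneousIdeal.toIdeal
  have hQ : Q.IsPrime := z.isPrime
  set mk := Ideal.Quotient.mk Q
  let P : (MvPolynomial (QuantumIndex m p q) K ⧸ Q)[X] :=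
    ∑ x : QuantumIndex m p q,
      monomial x.rank (mk (MvPolynomial.C (complementaryMinor L x.seq) * MvPolynomial.X x))
  have hle : ∀ x : QuantumIndex m p q, mk (MvPolynomial.X x) ≠ 0 → x ≤ α := fun x hx => by
    by_contra hxα
    exact hx (Ideal.Quotient.eq_zero_iff_mem.2 (hzα ⟨x, hxα, rfl⟩))
  have hdeg : P.natDegree ≤ α.rank := by
    refine natDegree_sum_le_of_forall_le _ _ fun x _ => ?_
    by_cases hx : mk (MvPolynomial.X x) = 0
    · simp [hx]
    · exact (natDegree_monomial_le _).trans (QuantumIndex.rank_le_rank_of_le (hle x hx))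
  have heval : ∀ i, P.eval (algebraMap K _ (s i)) = 0 := by
    intro i
    have h1 : hyperplaneForm q L (s i) ∈ Q := (Set.mem_iInter.1 hzH i) rfl
    rw [← Ideal.Quotient.eq_zero_iff_mem] at h1
    rw [← h1, hyperplaneForm, map_sum, eval_finsetSum]
    refine Finset.sum_congr rfl fun x _ => ?_
    have halg : algebraMap K (MvPolynomial (QuantumIndex m p q) K ⧸ Q) (s i) =
      mk (MvPolynomial.C (s i)) := rfl
    rw [eval_monomial, halg]
    simp only [map_mul, map_pow]
    ring
  have hP : P = 0 := eq_zero_of_natDegree_lt_card_of_eval_eq_zero P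
    ((algebraMap K (MvPolynomial (QuantumIndex m p q) K ⧸ Q)).injective.comp hs) heval
    (hdeg.trans_lt hα)
  obtain ⟨y, hy⟩ := MvPolynomial.exists_X_notMem_asHomogeneousIdeal z
  obtain ⟨x, hx, hmax⟩ := Finset.exists_max_image
    (Finset.univ.filter fun x : QuantumIndex m p q => MvPolynomial.X x ∉ Q)
    QuantumIndex.weight ⟨y, Finset.mem_filter.2 ⟨Finset.mem_univ _, hy⟩⟩
  have hxQ := (Finset.mem_filter.1 hx).2
  have hgt : ∀ y : QuantumIndex m p q, x.weight < y.weight → MvPolynomial.X y ∈ Q := by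
    intro y hxy
    by_contra hyQ
    exact absurd (hmax y (Finset.mem_filter.2 ⟨Finset.mem_univ _, hyQ⟩)) (not_le.2 hxy)
  have hcoeff := congrArg (fun P => P.coeff x.rank) hP
  simp only [P, finsetSum_coeff, coeff_zero] at hcoeff
  rw [Finset.sum_eq_single x, coeff_monomial, if_pos rfl, Ideal.Quotient.eq_zero_iff_mem] at hcoeff
  · rcases hQ.mem_or_mem hcoeff with h | h
    · exact hQ.ne_top (Ideal.eq_top_of_isUnit_mem _ h
        ((complementaryMinor_ne_zero hL x.seq).isUnit.map MvPolynomial.C))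
    · exact hxQ h
  · intro y _ hyx
    rw [coeff_monomial]
    split_ifs with hrank
    · rw [Ideal.Quotient.eq_zero_iff_mem]
      refine Ideal.mul_mem_left _ _ ?_
      have hw : y.weight = x.weight := by
        rw [← QuantumIndex.rank_add_sum_eq_weight, hrank, QuantumIndex.rank_add_sum_eq_weight]
      exact (hQ.mem_or_mem
        (X_mul_X_mem_of_weight_eq (by omega) hz hgt hw rfl hyx)).resolve_right hxQ
    · rfl
  · simp

end Emptiness

/-! ### Families of matrices of polynomials with bounded columns -/

section CurveMatrix

variable {m p : ℕ}

/-- The `(m+p) × p` matrix of polynomials of degree at most `q` in `t` whose `j`-th column is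
encoded by the sequence `v j`: the number `v j (i + (m + p) * l)` is the coefficient of `t^l` in
row `i`. In other words, the column is the polynomial `∑ e, v j e * s^e`, where `s^(m+p) = t` and
`s^i` stands for the `i`-th unit vector. The values `v j e` with `e ≥ (m + p) * (q + 1)` are not
used. -/
noncomputable def curveMatrix {S : Type*} [CommRing S] (m q : ℕ) (v : Fin p → ℕ → S) :
    Matrix (Fin (m + p)) (Fin p) S[X] :=
  Matrix.of fun i j => ∑ l ∈ Finset.range (q + 1), monomial l (v j (i + (m + p) * l))

/-- The quantum Plücker coordinates of `curveMatrix m q v`. -/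
noncomputable def curveCoord {S : Type*} [CommRing S] {q : ℕ} (v : Fin p → ℕ → S)
    (x : QuantumIndex m p q) : S :=
  (maximalMinor (curveMatrix m q v) x.seq).coeff x.exp

theorem coeff_det_curveMatrix {S : Type*} [CommRing S] {q : ℕ} (v : Fin p → ℕ → S)
    (f : Fin p → Fin (m + p)) (c : ℕ) :
    ((curveMatrix m q v).submatrix f id).det.coeff c =
      ∑ σ : Equiv.Perm (Fin p), (Equiv.Perm.sign σ : S) *
        ∑ l ∈ Fintype.piFinset fun _ : Fin p => Finset.range (q + 1),
          if ∑ j, l j = c then ∏ j, v j (f (σ j) + (m + p) * l j) else 0 := by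
  rw [Matrix.det_apply', finsetSum_coeff]
  refine Finset.sum_congr rfl fun σ _ => ?_
  rw [← C_eq_intCast, coeff_C_mul]
  congr 1
  simp only [Matrix.submatrix_apply, curveMatrix, Matrix.of_apply, id]
  rw [Finset.prod_univ_sum, finsetSum_coeff]
  refine Finset.sum_congr rfl fun l _ => ?_
  have : ∏ j, monomial (l j) (v j (f (σ j) + (m + p) * l j)) =
      monomial (∑ j, l j) (∏ j, v j (f (σ j) + (m + p) * l j)) := by
    simp_rw [← C_mul_X_pow_eq_monomial]
    rw [Finset.prod_mul_distrib, Finset.prod_pow_eq_pow_sum, map_prod]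
  rw [this, coeff_monomial]

theorem exists_of_coeff_det_curveMatrix_ne_zero {S : Type*} [CommRing S] {q : ℕ}
    {v : Fin p → ℕ → S} {f : Fin p → Fin (m + p)} {c : ℕ}
    (h : ((curveMatrix m q v).submatrix f id).det.coeff c ≠ 0) :
    ∃ (σ : Equiv.Perm (Fin p)) (l : Fin p → ℕ), ∑ j, l j = c ∧
      ∀ j, v j (f (σ j) + (m + p) * l j) ≠ 0 := by
  classical
  rw [coeff_det_curveMatrix] at h
  obtain ⟨σ, -, hσ⟩ := Finset.exists_ne_zero_of_sum_ne_zero h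
  obtain ⟨l, -, hl⟩ := Finset.exists_ne_zero_of_sum_ne_zero (right_ne_zero_of_mul hσ)
  split_ifs at hl with hc
  · exact ⟨σ, l, hc, fun j hj => hl (Finset.prod_eq_zero (Finset.mem_univ j) hj)⟩
  · exact absurd rfl hl

theorem map_curveMatrix {S T : Type*} [CommRing S] [CommRing T] (q : ℕ) (φ : S →+* T)
    (v : Fin p → ℕ → S) :
    (curveMatrix m q v).map (Polynomial.map φ) = curveMatrix m q fun j e => φ (v j e) := by
  ext i j : 2
  simp [curveMatrix, Polynomial.map_sum]

theorem map_maximalMinor_curveMatrix {S T : Type*} [CommRing S] [CommRing T] (q : ℕ) (φ : S →+* T)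
    (v : Fin p → ℕ → S) (α : Fin p ↪o Fin (m + p)) :
    (maximalMinor (curveMatrix m q v) α).map φ =
      maximalMinor (curveMatrix m q fun j e => φ (v j e)) α := by
  rw [← map_curveMatrix, maximalMinor, maximalMinor, ← coe_mapRingHom, RingHom.map_det]
  rfl

theorem map_curveCoord {S T : Type*} [CommRing S] [CommRing T] {q : ℕ} (φ : S →+* T)
    (v : Fin p → ℕ → S) (x : QuantumIndex m p q) :
    φ (curveCoord v x) = curveCoord (fun j e => φ (v j e)) x := by
  rw [curveCoord, curveCoord, ← map_maximalMinor_curveMatrix, coeff_map]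

/-- If the `j`-th column has degree at most `d j`, the minors have degree at most `∑ j, d j`. -/
theorem natDegree_maximalMinor_curveMatrix_le {S : Type*} [CommRing S] {q : ℕ}
    {v : Fin p → ℕ → S} {d : Fin p → ℕ} (hd : ∑ j, d j ≤ q)
    (hv : ∀ j e, v j e ≠ 0 → e / (m + p) ≤ d j) (α : Fin p ↪o Fin (m + p)) :
    (maximalMinor (curveMatrix m q v) α).natDegree ≤ q := by
  rw [natDegree_le_iff_coeff_eq_zero]
  intro c hc
  by_contra h
  obtain ⟨σ, l, hl, hne⟩ := exists_of_coeff_det_curveMatrix_ne_zero h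
  have : ∑ j, l j ≤ ∑ j, d j := Finset.sum_le_sum fun j _ => by
    have h1 := hv j _ (hne j)
    rwa [Nat.add_mul_div_left _ _ (α (σ j)).pos, Nat.div_eq_of_lt (α (σ j)).2, zero_add] at h1
  omega

theorem weight_le_of_curveCoord_ne_zero {S : Type*} [CommRing S] {q : ℕ}
    {v : Fin p → ℕ → S} {J : Fin p → ℕ} (hv : ∀ j e, v j e ≠ 0 → e ≤ J j) {x : QuantumIndex m p q}
    (hx : curveCoord v x ≠ 0) : x.weight ≤ ∑ j, J j := by
  obtain ⟨σ, l, hl, hne⟩ := exists_of_coeff_det_curveMatrix_ne_zero hx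
  have h1 := Finset.sum_le_sum fun j (_ : j ∈ Finset.univ) => hv j _ (hne j)
  rw [Finset.sum_add_distrib, ← Finset.mul_sum, hl,
    Equiv.sum_comp σ fun i => (x.seq i : ℕ)] at h1
  rw [QuantumIndex.weight, mul_comm]
  omega

theorem isHomogeneous_curveCoord {τ K : Type*} [Field K] {q : ℕ}
    {v : Fin p → ℕ → MvPolynomial τ K} (hv : ∀ j e, (v j e).IsHomogeneous 1)
    (x : QuantumIndex m p q) : (curveCoord v x).IsHomogeneous p := by
  rw [curveCoord, maximalMinor, coeff_det_curveMatrix]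
  refine MvPolynomial.IsHomogeneous.sum _ _ _ fun σ _ => ?_
  have : ((Equiv.Perm.sign σ : ℤ) : MvPolynomial τ K) =
      MvPolynomial.C ((Equiv.Perm.sign σ : ℤ) : K) := by simp
  rw [this]
  refine MvPolynomial.IsHomogeneous.C_mul (MvPolynomial.IsHomogeneous.sum _ _ _ fun l _ => ?_) _
  split_ifs
  · have := MvPolynomial.IsHomogeneous.prod Finset.univ _ (fun _ : Fin p => 1)
      fun j _ => hv j ((x.seq (σ j) : ℕ) + (m + p) * l j)
    simpa using this
  · exact MvPolynomial.isHomogeneous_zero _ _ _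

end CurveMatrix

section Family

variable {m p q : ℕ} (K : Type*) [Field K]

/-- The generic columns whose `j`-th member has degree at most `J j` in `s`. -/
noncomputable def genericColumn (J : Fin p → ℕ) (j : Fin p) (e : ℕ) :
    MvPolynomial (Fin p × ℕ) K :=
  if e ≤ J j then MvPolynomial.X (j, e) else 0

/-- The ideal of all polynomials in the quantum Plücker coordinates that vanish on the family of
matrices whose `j`-th column has degree at most `J j` in `s`. -/
noncomputable def familyIdeal (m q : ℕ) (J : Fin p → ℕ) :
    Ideal (MvPolynomial (QuantumIndex m p q) K) :=
  RingHom.ker (MvPolynomial.aeval (R := K) (curveCoord (m := m) (q := q) (genericColumn K J)))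

instance isPrime_familyIdeal (J : Fin p → ℕ) : (familyIdeal K m q J).IsPrime :=
  RingHom.ker_isPrime _

variable {K}

theorem isHomogeneous_genericColumn (J : Fin p → ℕ) (j : Fin p) (e : ℕ) :
    (genericColumn K J j e).IsHomogeneous 1 := by
  rw [genericColumn]
  split_ifs
  · exact MvPolynomial.isHomogeneous_X _ _
  · exact MvPolynomial.isHomogeneous_zero _ _ _

theorem le_of_genericColumn_ne_zero {J : Fin p → ℕ} (j : Fin p) (e : ℕ)
    (h : genericColumn K J j e ≠ 0) : e ≤ J j := by
  by_contra h'
  exact h (if_neg h')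

theorem isHomogeneous_familyIdeal (hp : 1 ≤ p) (J : Fin p → ℕ) :
    (familyIdeal K m q J).IsHomogeneous
      (MvPolynomial.homogeneousSubmodule (QuantumIndex m p q) K) := by
  classical
  intro d f hf
  rw [MvPolynomial.coe_decompose_eq_homogeneousComponent]
  rw [familyIdeal, RingHom.mem_ker] at hf ⊢
  have hhom : ∀ d, (MvPolynomial.aeval (R := K)
      (curveCoord (m := m) (q := q) (genericColumn K J))
      (MvPolynomial.homogeneousComponent d f)).IsHomogeneous (p * d) := fun d =>
    (MvPolynomial.homogeneousComponent_isHomogeneous d f).aeval _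
      fun x => isHomogeneous_curveCoord (isHomogeneous_genericColumn J) x
  have h1 := congrArg (MvPolynomial.homogeneousComponent (p * d)) hf
  rw [← MvPolynomial.sum_homogeneousComponent f, map_sum, map_sum, map_zero] at h1
  simp_rw [MvPolynomial.homogeneousComponent_of_mem
    ((MvPolynomial.mem_homogeneousSubmodule _ _).2 (hhom _))] at h1
  have hinj : ∀ e, p * d = p * e ↔ d = e := fun e => by
    constructor
    · exact Nat.eq_of_mul_eq_mul_left hp
    · rintro rfl; rfl
  simp_rw [hinj, Finset.sum_ite_eq, Finset.mem_range] at h1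
  split_ifs at h1 with hd
  · exact h1
  · rw [MvPolynomial.homogeneousComponent_eq_zero _ _ (by omega), map_zero]

theorem familyIdeal_anti {J J' : Fin p → ℕ} (h : J' ≤ J) :
    familyIdeal K m q J ≤ familyIdeal K m q J' := by
  intro f hf
  rw [familyIdeal, RingHom.mem_ker] at hf ⊢
  have h1 := congrArg (MvPolynomial.aeval (R := K) fun x : Fin p × ℕ => genericColumn K J' x.1 x.2)
    hf
  rw [MvPolynomial.comp_aeval_apply, map_zero] at h1
  convert h1 using 3
  ext1 x
  have h2 := map_curveCoord (MvPolynomial.aeval (R := K)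
    fun x : Fin p × ℕ => genericColumn K J' x.1 x.2).toRingHom (genericColumn K J) x
  refine Eq.trans ?_ h2.symm
  congr 1
  ext1 j
  ext1 e
  by_cases he : e ≤ J j
  · simp [genericColumn, he]
  · have : ¬ e ≤ J' j := fun h' => he (h'.trans (h j))
    simp [genericColumn, he, this]

theorem X_mem_familyIdeal_iff {J : Fin p → ℕ} {x : QuantumIndex m p q} :
    MvPolynomial.X x ∈ familyIdeal K m q J ↔ curveCoord (genericColumn K J) x = 0 := by
  rw [familyIdeal, RingHom.mem_ker, MvPolynomial.aeval_X]

theorem X_mem_familyIdeal_of_lt_weight {J : Fin p → ℕ} {x : QuantumIndex m p q}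
    (h : ∑ j, J j < x.weight) : MvPolynomial.X x ∈ familyIdeal K m q J := by
  rw [X_mem_familyIdeal_iff]
  by_contra hne
  exact absurd (weight_le_of_curveCoord_ne_zero le_of_genericColumn_ne_zero hne) (not_le.2 h)

/-- The coordinate of the leading terms of the columns is nonzero on the family. -/
theorem exists_X_notMem_familyIdeal (hpos : 0 < m + p) {J : Fin p → ℕ}
    (hJ : Function.Injective fun j => J j % (m + p)) (hq : ∑ j, J j / (m + p) ≤ q) :
    ∃ x : QuantumIndex m p q, x.weight = ∑ j, J j ∧ MvPolynomial.X x ∉ familyIdeal K m q J := by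
  classical
  let f : Fin p → Fin (m + p) := fun j => ⟨J j % (m + p), Nat.mod_lt _ hpos⟩
  have hf : Function.Injective f := fun i j h => hJ (congrArg Fin.val h)
  refine ⟨⟨sortedSeq f hf, ⟨∑ j, J j / (m + p), by omega⟩⟩, ?_, ?_⟩
  · rw [QuantumIndex.weight, sum_sortedSeq, Finset.sum_mul, ← Finset.sum_add_distrib]
    exact Finset.sum_congr rfl fun j _ => Nat.div_add_mod' _ _
  · rw [X_mem_familyIdeal_iff]
    intro h0
    -- specialize the columns to the monomials `s ^ J j`
    let φ := MvPolynomial.aeval (R := K) fun x : Fin p × ℕ => if x.2 = J x.1 then (1 : K) else 0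
    have h1 := map_curveCoord φ.toRingHom (genericColumn K J)
      (⟨sortedSeq f hf, ⟨∑ j, J j / (m + p), by omega⟩⟩ : QuantumIndex m p q)
    rw [h0, map_zero, eq_comm] at h1
    have h2 : (fun j e => φ.toRingHom (genericColumn K J j e)) =
        fun j e => if e = J j then (1 : K) else 0 := by
      ext j e
      by_cases he : e ≤ J j
      · simp [genericColumn, he, φ]
      · have : e ≠ J j := fun h => he h.le
        simp [genericColumn, he, this]
    rw [h2] at h1
    have h3 : ((curveMatrix m q fun j e => if e = J j then (1 : K) else 0).submatrix f id).det =
        X ^ ∑ j, J j / (m + p) := by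
      have : (curveMatrix m q fun j e => if e = J j then (1 : K) else 0).submatrix f id =
          Matrix.diagonal fun j => X ^ (J j / (m + p)) := by
        ext1 i j
        have hentry : ∀ l, ((f i : ℕ) + (m + p) * l = J j) ↔ (i = j ∧ l = J j / (m + p)) := by
          intro l
          constructor
          · intro h
            have hmod := congrArg (· % (m + p)) h
            have hdiv := congrArg (· / (m + p)) h
            simp only [Nat.add_mul_mod_self_left, Nat.mod_eq_of_lt (f i).2] at hmod
            simp only [Nat.add_mul_div_left _ _ hpos, Nat.div_eq_of_lt (f i).2, zero_add] at hdiv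
            exact ⟨hJ hmod, hdiv⟩
          · rintro ⟨rfl, rfl⟩
            exact Nat.mod_add_div _ _
        simp only [Matrix.submatrix_apply, curveMatrix, Matrix.of_apply, id, hentry]
        by_cases hij : i = j
        · subst hij
          rw [Matrix.diagonal_apply_eq, Finset.sum_eq_single (J i / (m + p))]
          · simp [X_pow_eq_monomial]
          · intro l _ hl
            simp [hl]
          · intro hl
            exfalso
            apply hl
            have := Finset.single_le_sum (f := fun j => J j / (m + p)) (fun _ _ => Nat.zero_le _)
              (Finset.mem_univ i)
            rw [Finset.mem_range]
            omega
        · simp [hij]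
      rw [this, Matrix.det_diagonal, Finset.prod_pow_eq_pow_sum]
    rw [← maximalMinor_sortedSeq _ f hf] at h3
    have h4 := congrArg (fun P => P.coeff (∑ j, J j / (m + p))) h3
    simp only [← C_eq_intCast, coeff_C_mul, coeff_X_pow_self] at h4
    rw [curveCoord] at h1
    simp only at h1
    rw [h1, mul_zero] at h4
    exact zero_ne_one h4

/-- The degrees in `s` of the columns, that is, their pole orders at infinity, can be lowered in
unit steps while they remain in a window of length `m + p`. -/
theorem exists_strictMono_sum_add_one_eq (hm : 1 ≤ m) (hp : 1 ≤ p) {J : Fin p → ℕ}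
    (hJ : StrictMono J) (hwin : ∀ i j, J i < J j + (m + p))
    (hsum : ∑ j : Fin p, (j : ℕ) < ∑ j, J j) :
    ∃ J' : Fin p → ℕ, J' ≤ J ∧ StrictMono J' ∧ (∀ i j, J' i < J' j + (m + p)) ∧
      ∑ j, J' j + 1 = ∑ j, J j := by
  classical
  -- it suffices to find an entry that can be lowered by one
  suffices h : ∃ i, 0 < J i ∧ (∀ a < i, J a + 1 < J i) ∧ ∀ a, J a + 1 < J i + (m + p) by
    obtain ⟨i, hpos, hlow, hw⟩ := h
    have hval : ∀ a, Function.update J i (J i - 1) a = if a = i then J i - 1 else J a :=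
      fun a => Function.update_apply _ _ _ _
    refine ⟨Function.update J i (J i - 1), ?_, ?_, ?_, ?_⟩
    · intro a
      rw [hval]
      split_ifs with h
      · subst h; exact Nat.sub_le _ _
      · exact le_rfl
    · intro a b hab
      rw [hval, hval]
      have := hJ hab
      split_ifs with ha hb hb
      · subst ha; subst hb; exact absurd hab (lt_irrefl _)
      · subst ha; omega
      · subst hb; have := hlow a hab; omega
      · exact this
    · intro a b
      rw [hval, hval]
      have := hwin a b
      have := hw a
      split_ifs with ha hb hb
      · omega
      · subst ha; omega
      · omega
      · omega
    · have e1 := Finset.add_sum_erase Finset.univ J (Finset.mem_univ i)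
      have e2 := Finset.add_sum_erase Finset.univ (Function.update J i (J i - 1))
        (Finset.mem_univ i)
      have e3 : ∑ l ∈ Finset.univ.erase i, Function.update J i (J i - 1) l =
          ∑ l ∈ Finset.univ.erase i, J l :=
        Finset.sum_congr rfl fun l hl => by rw [Function.update_of_ne (Finset.ne_of_mem_erase hl)]
      rw [Function.update_self] at e2
      omega
  -- an entry above a gap can be lowered; without gaps, `p < m + p` leaves room below the first one
  by_cases hgap : ∃ i j : Fin p, (j : ℕ) + 1 = i ∧ J j + 1 < J i
  · obtain ⟨i, j, hij, hgap⟩ := hgap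
    refine ⟨i, by omega, fun a ha => ?_, fun a => ?_⟩
    · have : J a ≤ J j := hJ.monotone (Fin.le_def.2 (by have := Fin.lt_def.1 ha; omega))
      omega
    · have := hwin a j
      omega
  · push Not at hgap
    have h0 : ∀ (b : ℕ) (hb : b < p), J ⟨b, hb⟩ ≤ J ⟨0, hp⟩ + b := by
      intro b
      induction b with
      | zero => intro hb; simp
      | succ b ih =>
        intro hb
        have h1 := ih (by omega)
        have h2 := hgap ⟨b + 1, hb⟩ ⟨b, by omega⟩ rfl
        omega
    have hpos : 0 < J ⟨0, hp⟩ := by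
      by_contra hzero
      have h1 : ∑ j, J j ≤ ∑ j : Fin p, (j : ℕ) := Finset.sum_le_sum fun j _ => by
        have := h0 j j.2
        simp only [Fin.eta] at this
        omega
      omega
    refine ⟨⟨0, hp⟩, hpos, fun a ha => absurd (Fin.lt_def.1 ha) (by simp), fun a => ?_⟩
    have := h0 a a.2
    have := a.2
    simp only [Fin.eta] at *
    omega

theorem injective_mod_of_window {n : ℕ} {J : Fin p → ℕ} (hJ : StrictMono J)
    (hwin : ∀ i j, J i < J j + n) : Function.Injective fun j => J j % n := by
  have key : ∀ i j, i < j → J i % n ≠ J j % n := by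
    intro i j hij h
    have h1 := hJ hij
    have h2 := hwin j i
    have h3 := (Nat.modEq_iff_dvd' h1.le).1 h
    have h4 := Nat.le_of_dvd (by omega) h3
    omega
  intro i j h
  rcases lt_trichotomy i j with hij | hij | hij
  · exact absurd h (key i j hij)
  · exact hij
  · exact absurd h.symm (key j i hij)

/-- The dimension of a family is at least the number of unit steps by which the pole orders of the
columns can be lowered: each step specializes the family to a strictly smaller one. -/
theorem le_coheight_familyIdeal (hm : 1 ≤ m) (hp : 1 ≤ p) (N : ℕ) {J : Fin p → ℕ}
    (hJ : StrictMono J) (hwin : ∀ i j, J i < J j + (m + p)) (hq : ∑ j, J j / (m + p) ≤ q)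
    (hN : ∑ j, J j = N + ∑ j : Fin p, (j : ℕ)) :
    ((N + 1 : ℕ) : ℕ∞) ≤ Order.coheight (⟨familyIdeal K m q J, inferInstance⟩ :
      PrimeSpectrum (MvPolynomial (QuantumIndex m p q) K)) := by
  induction N generalizing J with
  | zero =>
    obtain ⟨x, -, hx⟩ := exists_X_notMem_familyIdeal (K := K) (m := m) (by omega)
      (injective_mod_of_window hJ hwin) hq
    have hlt : familyIdeal K m q J < RingHom.ker (MvPolynomial.constantCoeff :
        MvPolynomial (QuantumIndex m p q) K →+* K) :=
      MvPolynomial.asIdeal_lt_ker_constantCoeff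
        (⟨⟨familyIdeal K m q J, isHomogeneous_familyIdeal hp J⟩, isPrime_familyIdeal K J,
          fun h => hx (h (MvPolynomial.X_mem_irrelevant x))⟩ : PluckerSpace K m p q)
    have hlt' : (⟨familyIdeal K m q J, inferInstance⟩ :
        PrimeSpectrum (MvPolynomial (QuantumIndex m p q) K)) <
        ⟨RingHom.ker MvPolynomial.constantCoeff, RingHom.ker_isPrime _⟩ := hlt
    refine le_trans ?_ (Order.coheight_add_one_le hlt')
    simp
  | succ N ih =>
    obtain ⟨J', hle, hJ', hwin', hsum⟩ := exists_strictMono_sum_add_one_eq hm hp hJ hwin (by omega)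
    have hq' : ∑ j, J' j / (m + p) ≤ q :=
      (Finset.sum_le_sum fun j _ => Nat.div_le_div_right (hle j)).trans hq
    obtain ⟨x, hxw, hx⟩ := exists_X_notMem_familyIdeal (K := K) (m := m) (by omega)
      (injective_mod_of_window hJ hwin) hq
    have hlt : (⟨familyIdeal K m q J, inferInstance⟩ :
        PrimeSpectrum (MvPolynomial (QuantumIndex m p q) K)) <
        ⟨familyIdeal K m q J', inferInstance⟩ :=
      show familyIdeal K m q J < familyIdeal K m q J' from
      SetLike.lt_iff_le_and_exists.2 ⟨familyIdeal_anti hle, MvPolynomial.X x,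
        X_mem_familyIdeal_of_lt_weight (by omega), hx⟩
    have h1 := add_le_add_left (ih hJ' hwin' hq' (by omega)) 1
    push_cast at h1 ⊢
    exact h1.trans (Order.coheight_add_one_le hlt)

end Family

/-! ### The family attached to a quantum Schubert variety -/

theorem Finset.sum_range_shift_of_periodic {M : Type*} [AddCommGroup M] {g : ℕ → M} {p : ℕ} {c : M}
    (hg : ∀ k, g (k + p) = g k + c) (a : ℕ) :
    ∑ j ∈ Finset.range p, g (a + j) = ∑ j ∈ Finset.range p, g j + a • c := by
  induction a with
  | zero => simp
  | succ a ih =>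
    have h1 := Finset.sum_range_succ (fun j => g (a + j)) p
    rw [Finset.sum_range_succ' (fun j => g (a + j)) p, hg, add_zero, ih] at h1
    have h2 : ∑ j ∈ Finset.range p, g (a + 1 + j) = ∑ j ∈ Finset.range p, g (a + (j + 1)) :=
      Finset.sum_congr rfl fun j _ => by rw [add_right_comm, add_assoc]
    rw [h2, succ_nsmul]
    have h3 := congrArg (· - g a) h1
    simp only [add_sub_cancel_right] at h3
    rw [h3]
    abel

namespace QuantumIndex

variable {m p q : ℕ}

/-- The periodic extension `α_{k+p} = α_k + (m + p)` of the sequence `α`. -/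
def periodicExt (hp : 1 ≤ p) (α : Fin p ↪o Fin (m + p)) (k : ℕ) : ℕ :=
  α ⟨k % p, Nat.mod_lt _ hp⟩ + (m + p) * (k / p)

/-- The degrees in `s` of the columns of a generic matrix in the Schubert variety of `α^(a)`: the
window of length `p` that starts at `a` in the periodic extension of `α`. -/
def poleOrder (hp : 1 ≤ p) (x : QuantumIndex m p q) (j : Fin p) : ℕ :=
  periodicExt hp x.seq (x.exp + j)

theorem periodicExt_add (hp : 1 ≤ p) (α : Fin p ↪o Fin (m + p)) (k : ℕ) :
    periodicExt hp α (k + p) = periodicExt hp α k + (m + p) := by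
  simp only [periodicExt, Nat.add_mod_right, Nat.add_div_right _ (show 0 < p from hp)]
  ring

theorem periodicExt_of_lt (hp : 1 ≤ p) (α : Fin p ↪o Fin (m + p)) (j : Fin p) :
    periodicExt hp α j = α j := by
  simp [periodicExt, Nat.mod_eq_of_lt j.2, Nat.div_eq_of_lt j.2]

theorem periodicExt_div (hp : 1 ≤ p) (α : Fin p ↪o Fin (m + p)) (k : ℕ) :
    periodicExt hp α k / (m + p) = k / p := by
  rw [periodicExt, Nat.add_mul_div_left _ _ (by omega), Nat.div_eq_of_lt (Fin.is_lt _), zero_add]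

theorem strictMono_periodicExt (hp : 1 ≤ p) (α : Fin p ↪o Fin (m + p)) :
    StrictMono (periodicExt hp α) := by
  intro k l hkl
  rw [periodicExt, periodicExt]
  rcases (Nat.div_le_div_right (c := p) hkl.le).eq_or_lt with h | h
  · have hmod : k % p < l % p := by
      have h1 := Nat.div_add_mod k p
      have h2 := Nat.div_add_mod l p
      rw [h] at h1
      omega
    have h3 : α ⟨k % p, Nat.mod_lt _ hp⟩ < α ⟨l % p, Nat.mod_lt _ hp⟩ :=
      α.strictMono (Fin.mk_lt_mk.2 hmod)
    have h4 := Fin.lt_def.1 h3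
    rw [h]
    omega
  · have h1 := Nat.mul_le_mul_left (m + p) (Nat.succ_le_of_lt h)
    have h2 := (α ⟨k % p, Nat.mod_lt _ hp⟩).2
    rw [Nat.mul_succ] at h1
    omega

theorem strictMono_poleOrder (hp : 1 ≤ p) (x : QuantumIndex m p q) :
    StrictMono (poleOrder hp x) := fun i j hij =>
  strictMono_periodicExt hp _ (by have := Fin.lt_def.1 hij; omega)

theorem poleOrder_lt_add (hp : 1 ≤ p) (x : QuantumIndex m p q) (i j : Fin p) :
    poleOrder hp x i < poleOrder hp x j + (m + p) := by
  rw [poleOrder, poleOrder, ← periodicExt_add]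
  exact strictMono_periodicExt hp _ (by omega)

theorem sum_poleOrder (hp : 1 ≤ p) (x : QuantumIndex m p q) :
    ∑ j, poleOrder hp x j = x.weight := by
  have h := Finset.sum_range_shift_of_periodic (g := fun k => (periodicExt hp x.seq k : ℤ)) (p := p)
    (c := ((m + p : ℕ) : ℤ)) (fun k => by rw [periodicExt_add]; push_cast; ring) x.exp
  rw [← Fin.sum_univ_eq_sum_range (fun k => (periodicExt hp x.seq (x.exp + k) : ℤ)),
    ← Fin.sum_univ_eq_sum_range (fun k => (periodicExt hp x.seq k : ℤ))] at h
  simp_rw [periodicExt_of_lt] at h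
  rw [weight]
  simp only [poleOrder]
  zify
  rw [h]
  simp
  ring

theorem sum_poleOrder_div (hp : 1 ≤ p) (x : QuantumIndex m p q) :
    ∑ j, poleOrder hp x j / (m + p) = x.exp := by
  have h := Finset.sum_range_shift_of_periodic (g := fun k => ((k / p : ℕ) : ℤ)) (p := p)
    (c := 1) (fun k => by rw [Nat.add_div_right _ (show 0 < p from hp)]; simp) x.exp
  rw [Finset.sum_eq_zero (s := Finset.range p) (f := fun k => ((k / p : ℕ) : ℤ)) (fun j hj => by
      rw [Nat.div_eq_of_lt (Finset.mem_range.1 hj)]; rfl), zero_add,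
    ← Fin.sum_univ_eq_sum_range (fun k => (((x.exp + k) / p : ℕ) : ℤ))] at h
  simp only [poleOrder, periodicExt_div]
  zify
  push_cast at h
  rw [h]
  simp

end QuantumIndex

section SchubertFamily

open QuantumIndex

variable {m p q : ℕ} {K : Type*} [Field K]

/-- The coordinates that do not vanish on the family attached to `α^(a)` have index at most
`α^(a)`. If the exponents `e j` of a nonzero term satisfy `e j ≤ J j`, then
`∑ j, ⌊(t - J j) / (m + p)⌋ ≤ ∑ j, ⌊(t - e j) / (m + p)⌋` for every threshold `t`. For
`0 ≤ t < m + p` both sums are, up to the exponents of the two indices, the numbers of entries of the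
sequences that exceed `t`, with a minus sign. -/
theorem le_of_X_notMem_familyIdeal (hp : 1 ≤ p) {x y : QuantumIndex m p q}
    (h : MvPolynomial.X y ∉ familyIdeal K m q (poleOrder hp x)) : y ≤ x := by
  classical
  rw [X_mem_familyIdeal_iff] at h
  obtain ⟨σ, l, hl, hne⟩ := exists_of_coeff_det_curveMatrix_ne_zero h
  have hle : ∀ j, (y.seq (σ j) : ℕ) + (m + p) * l j ≤ poleOrder hp x j := fun j =>
    le_of_genericColumn_ne_zero _ _ (hne j)
  have hpos : 0 < m + p := by omega
  have hexp : (y.exp : ℕ) ≤ x.exp := by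
    rw [← hl, ← sum_poleOrder_div hp x]
    refine Finset.sum_le_sum fun j _ => ?_
    have h1 := Nat.div_le_div_right (c := m + p) (hle j)
    rwa [Nat.add_mul_div_left _ _ hpos, Nat.div_eq_of_lt (Fin.is_lt _), zero_add] at h1
  refine ⟨hexp, fun i j hij => ?_⟩
  by_contra hlt
  rw [not_le] at hlt
  set t : ℕ := (x.seq j : ℕ)
  have hfloor : ∀ (β : Fin p ↪o Fin (m + p)) (i : Fin p),
      ((t : ℤ) - (β i : ℕ)) / ((m + p : ℕ) : ℤ) = if x.seq j < β i then -1 else 0 := by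
    intro β i
    have h1 := (x.seq j).2
    have h2 := (β i).2
    split_ifs with h3
    · have h4 := Fin.lt_def.1 h3
      rw [Int.ediv_eq_iff_of_pos (by omega)]
      omega
    · have h4 := Fin.le_def.1 (not_lt.1 h3)
      exact Int.ediv_eq_zero_of_lt (by omega) (by omega)
  have hcount : ∀ β : Fin p ↪o Fin (m + p),
      ∑ i, ((t : ℤ) - (β i : ℕ)) / ((m + p : ℕ) : ℤ) =
        -((Finset.univ.filter fun i => x.seq j < β i).card : ℤ) := by
    intro β
    simp_rw [hfloor, Finset.sum_ite, Finset.sum_const_zero, add_zero, Finset.sum_const]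
    simp
  have h1 : ∑ i, ((t : ℤ) - (poleOrder hp x i : ℕ)) / ((m + p : ℕ) : ℤ) =
      -((Finset.univ.filter fun i => x.seq j < x.seq i).card : ℤ) - (x.exp : ℕ) := by
    have h := Finset.sum_range_shift_of_periodic
      (g := fun k => ((t : ℤ) - (periodicExt hp x.seq k : ℕ)) / ((m + p : ℕ) : ℤ)) (p := p)
      (c := -1) (fun k => by
        rw [periodicExt_add, ← Int.add_mul_ediv_right _ _ (show ((m + p : ℕ) : ℤ) ≠ 0 by omega)]
        congr 1
        push_cast
        ring) x.exp
    rw [← Fin.sum_univ_eq_sum_range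
        (fun k => ((t : ℤ) - (periodicExt hp x.seq (x.exp + k) : ℕ)) / ((m + p : ℕ) : ℤ)),
      ← Fin.sum_univ_eq_sum_range
        (fun k => ((t : ℤ) - (periodicExt hp x.seq k : ℕ)) / ((m + p : ℕ) : ℤ))] at h
    simp_rw [periodicExt_of_lt] at h
    rw [hcount] at h
    simp only [poleOrder]
    rw [h]
    simp
    ring
  have h2 : ∑ i, ((t : ℤ) - ((y.seq (σ i) : ℕ) + (m + p) * l i : ℕ)) / ((m + p : ℕ) : ℤ) =
      -((Finset.univ.filter fun i => x.seq j < y.seq i).card : ℤ) - (y.exp : ℕ) := by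
    have h3 : ∀ i, ((t : ℤ) - ((y.seq (σ i) : ℕ) + (m + p) * l i : ℕ)) / ((m + p : ℕ) : ℤ) =
        ((t : ℤ) - (y.seq (σ i) : ℕ)) / ((m + p : ℕ) : ℤ) - l i := fun i => by
      rw [sub_eq_add_neg (_ / _) (l i : ℤ),
        ← Int.add_mul_ediv_right _ _ (show ((m + p : ℕ) : ℤ) ≠ 0 by omega)]
      congr 1
      push_cast
      ring
    simp_rw [h3]
    rw [Finset.sum_sub_distrib, Equiv.sum_comp σ fun i =>
      ((t : ℤ) - (y.seq i : ℕ)) / ((m + p : ℕ) : ℤ), hcount, ← hl]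
    push_cast
    rfl
  have h3 : ∑ i, ((t : ℤ) - (poleOrder hp x i : ℕ)) / ((m + p : ℕ) : ℤ) ≤
      ∑ i, ((t : ℤ) - ((y.seq (σ i) : ℕ) + (m + p) * l i : ℕ)) / ((m + p : ℕ) : ℤ) :=
    Finset.sum_le_sum fun i _ => Int.ediv_le_ediv (by omega) (by have := hle i; omega)
  have h4 : (Finset.univ.filter fun i => x.seq j < x.seq i).card = p - 1 - j := by
    rw [← Fin.card_Ioi]
    congr 1
    ext i
    simp
  have h5 : p - i ≤ (Finset.univ.filter fun i => x.seq j < y.seq i).card := by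
    rw [← Fin.card_Ici]
    refine Finset.card_le_card fun i' hi' => ?_
    rw [Finset.mem_filter]
    exact ⟨Finset.mem_univ _, hlt.trans_le (y.seq.monotone (Finset.mem_Ici.1 hi'))⟩
  rw [h1, h2, h4] at h3
  have := i.2
  have := j.2
  omega

end SchubertFamily

section Density

variable {m p q : ℕ} {F : Type*} [Field F]

/-- The columns `t^(d j) e_{m+j} + e_{m+j-1}`, with rows counted from zero. Two of the maximal
minors of this matrix are `t^(∑ j, d j)` and `1`. -/
def modelColumn (F : Type*) [Field F] (m : ℕ) (d : Fin p → ℕ) (j : Fin p) (e : ℕ) : F :=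
  (if e = m + j + (m + p) * d j then 1 else 0) + if e = m + j - 1 then 1 else 0

theorem curveMatrix_modelColumn_apply (hm : 1 ≤ m) {d : Fin p → ℕ} (hd : ∀ j, d j ≤ q)
    (i : Fin (m + p)) (j : Fin p) :
    curveMatrix m q (modelColumn F m d) i j =
      (if (i : ℕ) = m + j then X ^ d j else 0) + if (i : ℕ) = m + j - 1 then 1 else 0 := by
  classical
  have hpos : 0 < m + p := by omega
  have hj := j.2
  have hdig : ∀ (r : ℕ) (l l' : ℕ), r < m + p →
      ((i : ℕ) + (m + p) * l = r + (m + p) * l' ↔ (i : ℕ) = r ∧ l = l') := by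
    intro r l l' hr
    constructor
    · intro h
      have hmod := congrArg (· % (m + p)) h
      have hdiv := congrArg (· / (m + p)) h
      simp only [Nat.add_mul_mod_self_left, Nat.mod_eq_of_lt i.2, Nat.mod_eq_of_lt hr] at hmod
      simp only [Nat.add_mul_div_left _ _ hpos, Nat.div_eq_of_lt i.2, Nat.div_eq_of_lt hr,
        zero_add] at hdiv
      exact ⟨hmod, hdiv⟩
    · rintro ⟨h, rfl⟩
      rw [h]
  have h1 : ∀ l, ((i : ℕ) + (m + p) * l = m + j + (m + p) * d j ↔ (i : ℕ) = m + j ∧ l = d j) :=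
    fun l => hdig _ _ _ (by omega)
  have h2 : ∀ l, ((i : ℕ) + (m + p) * l = m + j - 1 ↔ (i : ℕ) = m + j - 1 ∧ l = 0) := fun l => by
    have := hdig (m + j - 1) l 0 (by omega)
    rwa [mul_zero, add_zero] at this
  simp only [curveMatrix, Matrix.of_apply, modelColumn, h1, h2, map_add, Finset.sum_add_distrib]
  congr 1
  · rw [Finset.sum_eq_single (d j)]
    · split_ifs <;> simp_all [X_pow_eq_monomial]
    · intro l _ hl
      simp [hl]
    · intro hl
      exact absurd (Finset.mem_range.2 (Nat.lt_succ_of_le (hd j))) hl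
  · rw [Finset.sum_eq_single 0]
    · split_ifs <;> simp_all
    · intro l _ hl
      simp [hl]
    · intro hl
      exact absurd (Finset.mem_range.2 (Nat.succ_pos q)) hl

/-- The last `p` rows. -/
def lastRows (m p : ℕ) : Fin p ↪o Fin (m + p) :=
  Fin.natAddOrderEmb m

/-- The `p` rows before the last row. -/
def rowsBeforeLast (hm : 1 ≤ m) (p : ℕ) : Fin p ↪o Fin (m + p) :=
  OrderEmbedding.ofStrictMono (fun i => ⟨m - 1 + i, by omega⟩)
    fun i j h => Fin.mk_lt_mk.2 (by have := Fin.lt_def.1 h; omega)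

theorem maximalMinor_modelColumn_lastRows (hm : 1 ≤ m) {d : Fin p → ℕ} (hd : ∀ j, d j ≤ q) :
    maximalMinor (curveMatrix m q (modelColumn F m d)) (lastRows m p) = X ^ ∑ j, d j := by
  rw [maximalMinor, Matrix.det_of_isUpperTriangular, ← Finset.prod_pow_eq_pow_sum]
  · refine Finset.prod_congr rfl fun j _ => ?_
    have : ((lastRows m p j : Fin (m + p)) : ℕ) = m + j := rfl
    rw [Matrix.submatrix_apply, id, curveMatrix_modelColumn_apply hm hd, this, if_pos rfl,
      if_neg (by omega), add_zero]
  · intro i j hij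
    have hij' : (j : ℕ) < i := hij
    have : ((lastRows m p i : Fin (m + p)) : ℕ) = m + i := rfl
    rw [Matrix.submatrix_apply, id, curveMatrix_modelColumn_apply hm hd, this,
      if_neg (by omega), if_neg (by omega), add_zero]

theorem maximalMinor_modelColumn_rowsBeforeLast (hm : 1 ≤ m) {d : Fin p → ℕ} (hd : ∀ j, d j ≤ q) :
    maximalMinor (curveMatrix m q (modelColumn F m d)) (rowsBeforeLast hm p) = 1 := by
  rw [maximalMinor, Matrix.det_of_isLowerTriangular]
  · refine Finset.prod_eq_one fun j _ => ?_
    have : ((rowsBeforeLast hm p j : Fin (m + p)) : ℕ) = m - 1 + j := rfl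
    rw [Matrix.submatrix_apply, id, curveMatrix_modelColumn_apply hm hd, this,
      if_neg (by omega), if_pos (by omega), zero_add]
  · intro i j hij
    have hij' : (i : ℕ) < j := hij
    have : ((rowsBeforeLast hm p i : Fin (m + p)) : ℕ) = m - 1 + i := rfl
    rw [Matrix.submatrix_apply, id, curveMatrix_modelColumn_apply hm hd, this,
      if_neg (by omega), if_neg (by omega), add_zero]

/-- A matrix with two coprime maximal minors, one of them of degree `q`, represents a curve. -/
theorem representsCurve_of_resultant_ne_zero {M : Matrix (Fin (m + p)) (Fin p) F[X]}
    (hdeg : ∀ α, (maximalMinor M α).natDegree ≤ q) (α β : Fin p ↪o Fin (m + p))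
    (hα : (maximalMinor M α).coeff q ≠ 0)
    (hres : resultant (maximalMinor M α) (maximalMinor M β) q q ≠ 0) : RepresentsCurve q M where
  rank_eq t := by
    by_contra! h
    rcases Nat.eq_zero_or_pos q with rfl | hq
    · have h1 := h α
      rw [eq_C_of_natDegree_le_zero (hdeg α), eval_C] at h1
      exact hα h1
    · obtain ⟨a, b, -, -, hab⟩ := exists_mul_add_mul_eq_C_resultant _ _ (hdeg α) (hdeg β)
        (Or.inl hq.ne')
      have h1 := congrArg (eval t) hab
      rw [eval_add, eval_mul, eval_mul, h α, h β, eval_C, zero_mul, zero_mul, add_zero] at h1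
      exact hres h1.symm
  natDegree_le := hdeg
  coeff_ne_zero := ⟨α, hα⟩

/-- A polynomial that vanishes at all curves vanishes at all matrices whose columns have degrees at
most `d j`, where `∑ j, d j = q`: on the line that joins such a matrix to a matrix representing a
curve, all but finitely many points represent curves. -/
theorem aeval_curveCoord_eq_zero {K : Type*} [Field K] [Algebra K F] [Infinite F] (hm : 1 ≤ m)
    {f : MvPolynomial (QuantumIndex m p q) K}
    (hf : ∀ M : Matrix (Fin (m + p)) (Fin p) F[X], RepresentsCurve q M →
      MvPolynomial.aeval (quantumPlucker q M) f = 0)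
    {d : Fin p → ℕ} (hd : ∑ j, d j = q) {c : Fin p → ℕ → F}
    (hc : ∀ j e, c j e ≠ 0 → e / (m + p) ≤ d j) :
    MvPolynomial.aeval (curveCoord (q := q) c) f = 0 := by
  have hdj : ∀ j, d j ≤ q := fun j =>
    hd ▸ Finset.single_le_sum (fun _ _ => Nat.zero_le _) (Finset.mem_univ j)
  set N := modelColumn F m d with hN
  have hNd : ∀ j e, N j e ≠ 0 → e / (m + p) ≤ d j := by
    intro j e he
    have hj := j.2
    by_contra hlt
    apply he
    rw [hN, modelColumn, if_neg, if_neg, add_zero]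
    · rintro rfl
      rw [Nat.div_eq_of_lt (by omega)] at hlt
      omega
    · rintro rfl
      rw [Nat.add_mul_div_left _ _ (by omega), Nat.div_eq_of_lt (by omega)] at hlt
      omega
  -- the line through `c` and the model matrix, with parameter `ε`
  let v : Fin p → ℕ → F[X] := fun j e => C (c j e) + X * C (N j e - c j e)
  have hv : ∀ ε : F, (fun j e => (Polynomial.aeval ε : F[X] →ₐ[F] F).toRingHom (v j e)) =
      fun j e => c j e + ε * (N j e - c j e) := by
    intro ε
    ext j e
    simp [v]
  have hvd : ∀ ε j e, c j e + ε * (N j e - c j e) ≠ 0 → e / (m + p) ≤ d j := by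
    intro ε j e h
    by_cases h1 : c j e = 0
    · by_cases h2 : N j e = 0
      · simp [h1, h2] at h
      · exact hNd j e h2
    · exact hc j e h1
  have hP : ∀ ε, ((MvPolynomial.aeval (curveCoord (q := q) v) f : F[X])).eval ε =
      MvPolynomial.aeval (curveCoord (q := q) fun j e => c j e + ε * (N j e - c j e)) f := by
    intro ε
    have h1 := MvPolynomial.comp_aeval_apply (R := K) (f := curveCoord (q := q) v)
      ((Polynomial.aeval ε : F[X] →ₐ[F] F).restrictScalars K) f
    rw [AlgHom.restrictScalars_apply, Polynomial.coe_aeval_eq_eval] at h1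
    rw [h1]
    congr 2
    ext x
    exact (map_curveCoord (Polynomial.aeval ε : F[X] →ₐ[F] F).toRingHom v x).trans
      (by rw [hv])
  set D₁ := maximalMinor (curveMatrix m q v) (lastRows m p)
  set D₂ := maximalMinor (curveMatrix m q v) (rowsBeforeLast hm p)
  have hmap : ∀ ε α, (maximalMinor (curveMatrix m q v) α).map
      (Polynomial.aeval ε : F[X] →ₐ[F] F).toRingHom =
      maximalMinor (curveMatrix m q fun j e => c j e + ε * (N j e - c j e)) α := by
    intro ε α
    rw [map_maximalMinor_curveMatrix, hv]
  set g : F[X] := D₁.coeff q * resultant D₁ D₂ q q with hg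
  have hgε : ∀ ε, g.eval ε =
      (maximalMinor (curveMatrix m q fun j e => c j e + ε * (N j e - c j e))
        (lastRows m p)).coeff q *
      resultant (maximalMinor (curveMatrix m q fun j e => c j e + ε * (N j e - c j e))
          (lastRows m p))
        (maximalMinor (curveMatrix m q fun j e => c j e + ε * (N j e - c j e))
          (rowsBeforeLast hm p)) q q := by
    intro ε
    rw [← hmap, ← hmap, resultant_map_map, coeff_map, hg, eval_mul]
    rfl
  have hg0 : g ≠ 0 := by
    intro h0
    have h1 := hgε 1
    rw [h0, eval_zero] at h1
    have h2 : (fun j e => c j e + 1 * (N j e - c j e)) = N := by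
      ext j e
      ring
    rw [h2, maximalMinor_modelColumn_lastRows hm hdj,
      maximalMinor_modelColumn_rowsBeforeLast hm hdj, resultant_one_right, hd,
      coeff_X_pow_self] at h1
    simp at h1
  have hzero : (MvPolynomial.aeval (curveCoord (q := q) v) f : F[X]) * g = 0 := by
    refine Polynomial.funext fun ε => ?_
    rw [eval_mul, eval_zero]
    by_cases h : g.eval ε = 0
    · rw [h, mul_zero]
    · rw [hgε] at h
      have hcurve := representsCurve_of_resultant_ne_zero
        (natDegree_maximalMinor_curveMatrix_le hd.le (hvd ε)) _ _ (left_ne_zero_of_mul h)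
        (right_ne_zero_of_mul h)
      rw [hP]
      exact (congrArg (· * _) (hf _ hcurve)).trans (zero_mul _)
  have h0 := hP 0
  rw [(mul_eq_zero.1 hzero).resolve_right hg0, eval_zero] at h0
  simpa using h0.symm

end Density

section Schubert

open QuantumIndex

variable {m p q : ℕ} {K : Type*} [Field K]

theorem mem_familyIdeal_of_forall_representsCurve (hm : 1 ≤ m) (hp : 1 ≤ p)
    {f : MvPolynomial (QuantumIndex m p q) K}
    (hf : ∀ M : Matrix (Fin (m + p)) (Fin p) (AlgebraicClosure K)[X], RepresentsCurve q M →
      MvPolynomial.aeval (quantumPlucker q M) f = 0) {J : Fin p → ℕ}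
    (hJ : ∑ j, J j / (m + p) ≤ q) : f ∈ familyIdeal K m q J := by
  classical
  -- enlarge the first column degree so that the degrees add up to `q`
  let d : Fin p → ℕ := fun j => J j / (m + p) +
    if j = ⟨0, hp⟩ then q - ∑ j, J j / (m + p) else 0
  have hd : ∑ j, d j = q := by
    simp only [d, Finset.sum_add_distrib, Finset.sum_ite_eq', Finset.mem_univ, if_true]
    omega
  rw [familyIdeal, RingHom.mem_ker]
  apply MvPolynomial.map_injective (algebraMap K (AlgebraicClosure K))
    (algebraMap K (AlgebraicClosure K)).injective
  refine MvPolynomial.funext fun u => ?_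
  rw [map_zero, map_zero, MvPolynomial.eval_map, ← MvPolynomial.aeval_def,
    MvPolynomial.comp_aeval_apply]
  have h1 : (fun x : QuantumIndex m p q =>
      MvPolynomial.aeval (R := K) u (curveCoord (genericColumn K J) x)) =
      curveCoord fun j e => MvPolynomial.aeval (R := K) u (genericColumn K J j e) := by
    ext x
    exact map_curveCoord (MvPolynomial.aeval (R := K) u).toRingHom _ x
  rw [h1]
  refine aeval_curveCoord_eq_zero hm hf hd fun j e he => ?_
  have h2 : genericColumn K J j e ≠ 0 := fun h => he (by rw [h, map_zero])
  exact (Nat.div_le_div_right (le_of_genericColumn_ne_zero j e h2)).trans (Nat.le_add_right _ _)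

theorem zeroLocus_familyIdeal_subset_quantumSchubert (hm : 1 ≤ m) (hp : 1 ≤ p)
    (α : QuantumIndex m p q) :
    ProjectiveSpectrum.zeroLocus (MvPolynomial.homogeneousSubmodule (QuantumIndex m p q) K)
      (familyIdeal K m q (poleOrder hp α) : Set (MvPolynomial (QuantumIndex m p q) K)) ⊆
      quantumSchubert K α := by
  intro z hz
  refine ⟨fun f hf => hz (mem_familyIdeal_of_forall_representsCurve hm hp hf.2 ?_), ?_⟩
  · rw [sum_poleOrder_div]
    omega
  · rintro _ ⟨y, hy, rfl⟩
    refine hz ?_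
    by_contra h
    exact hy (le_of_X_notMem_familyIdeal hp h)

theorem isHomogeneous_hyperplaneForm (L : Matrix (Fin (m + p)) (Fin m) K) (s : K) :
    (hyperplaneForm q L s).IsHomogeneous 1 :=
  MvPolynomial.IsHomogeneous.sum _ _ _ fun _ _ => MvPolynomial.isHomogeneous_C_mul_X _ _

theorem zeroLocus_range_hyperplaneForm {ι : Type*} (L : Matrix (Fin (m + p)) (Fin m) K)
    (s : ι → K) :
    ProjectiveSpectrum.zeroLocus (MvPolynomial.homogeneousSubmodule (QuantumIndex m p q) K)
      (Set.range fun i => hyperplaneForm q L (s i)) = ⋂ i, hyperplane q L (s i) := by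
  simp only [hyperplane, ← ProjectiveSpectrum.zeroLocus_iUnion, Set.iUnion_singleton_eq_range]

/-- The equations that define a quantum Schubert variety. -/
def schubertEquations (K : Type*) [Field K] (α : QuantumIndex m p q) :
    Set (MvPolynomial (QuantumIndex m p q) K) :=
  {f | (∃ d, f.IsHomogeneous d) ∧
      ∀ M : Matrix (Fin (m + p)) (Fin p) (AlgebraicClosure K)[X],
        RepresentsCurve q M → MvPolynomial.aeval (quantumPlucker q M) f = 0} ∪
    {f | ∃ y : QuantumIndex m p q, ¬ y ≤ α ∧ f = MvPolynomial.X y}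

theorem zeroLocus_schubertEquations (α : QuantumIndex m p q) :
    ProjectiveSpectrum.zeroLocus (MvPolynomial.homogeneousSubmodule (QuantumIndex m p q) K)
      (schubertEquations K α) = quantumSchubert K α :=
  ProjectiveSpectrum.zeroLocus_union _ _ _

end Schubert

theorem mainTheorem3 {K : Type*} [Field K] [Infinite K] (m p q : ℕ) (hm : 1 ≤ m) (hp : 1 ≤ p)
    (L : Matrix (Fin (m + p)) (Fin m) K)
    (hL : ∀ β : Fin m ↪o Fin (m + p), (L.submatrix β id).det ≠ 0)
    (k : ℕ) (s : Fin k → K) (hs : Function.Injective s) (α : QuantumIndex m p q) :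
    (k ≤ α.rank →
      topologicalKrullDim
        (↥(quantumSchubert K α ∩ ⋂ i, hyperplane q L (s i)) : Type _) =
          ((α.rank - k : ℕ) : WithBot ℕ∞)) ∧
    (α.rank < k → quantumSchubert K α ∩ ⋂ i, hyperplane q L (s i) = ∅) := by
  refine ⟨fun hk => ?_, fun hk =>
    quantumSchubert_inter_hyperplane_eq_empty hp hL hs α (by simpa using hk)⟩
  obtain ⟨d, hd⟩ := Nat.exists_eq_add_of_le hk
  -- complete `s` to a family of `α.rank + 1` distinct parameters
  have hinf : Infinite ↥(Set.range s)ᶜ := (Set.finite_range s).infinite_compl.to_subtype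
  let s' : Fin (d + 1) → K := fun i => Infinite.natEmbedding ↥(Set.range s)ᶜ i
  have hs' : Function.Injective s' := fun i j h =>
    Fin.ext ((Infinite.natEmbedding ↥(Set.range s)ᶜ).injective (Subtype.ext h))
  have hss' : Function.Injective (Sum.elim s s') :=
    hs.sumElim hs' fun i j h => (Infinite.natEmbedding ↥(Set.range s)ᶜ j).2 ⟨i, h⟩
  have hempty := quantumSchubert_inter_hyperplane_eq_empty hp hL hss' α
    (by simp only [Fintype.card_sum, Fintype.card_fin]; omega)
  have hinter : ⋂ i, hyperplane q L (Sum.elim s s' i) =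
      (⋂ i, hyperplane q L (s i)) ∩ ⋂ i, hyperplane q L (s' i) := by
    rw [Set.iInter_sum]
    rfl
  have hdk : α.rank - k = d := by omega
  rw [hdk]
  refine le_antisymm ?_ ?_
  · have h1 := MvPolynomial.topologicalKrullDim_lt_of_inter_eq_empty
      (schubertEquations K α ∪ Set.range fun i => hyperplaneForm q L (s i))
      (h := fun i => hyperplaneForm q L (s' i)) (fun i => isHomogeneous_hyperplaneForm L _) (by
        rw [ProjectiveSpectrum.zeroLocus_union, ProjectiveSpectrum.zeroLocus_union,
          zeroLocus_schubertEquations, zeroLocus_range_hyperplaneForm,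
          zeroLocus_range_hyperplaneForm, Set.inter_assoc, ← hinter, hempty])
    rw [ProjectiveSpectrum.zeroLocus_union, zeroLocus_schubertEquations,
      zeroLocus_range_hyperplaneForm] at h1
    rw [Nat.cast_add, Nat.cast_one] at h1
    exact (ENat.WithBot.lt_add_one_iff).1 h1
  · have hsub := zeroLocus_familyIdeal_subset_quantumSchubert (K := K) hm hp α
    refine MvPolynomial.le_topologicalKrullDim_of_zeroLocus_eq_empty (k := k)
      (isHomogeneous_familyIdeal (K := K) hp (QuantumIndex.poleOrder hp α)) inferInstance
      (h := fun i => hyperplaneForm q L (Sum.elim s s' i))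
      (fun i => isHomogeneous_hyperplaneForm L _) ?_ ?_ ?_
    · rw [ProjectiveSpectrum.zeroLocus_union, zeroLocus_range_hyperplaneForm,
        Set.eq_empty_iff_forall_notMem]
      rintro z ⟨hz, hz'⟩
      exact Set.eq_empty_iff_forall_notMem.1 hempty z ⟨hsub hz, hz'⟩
    · have := le_coheight_familyIdeal (K := K) (q := q) hm hp α.rank
        (QuantumIndex.strictMono_poleOrder hp α)
        (QuantumIndex.poleOrder_lt_add hp α) (by rw [QuantumIndex.sum_poleOrder_div]; omega)
        (by rw [QuantumIndex.sum_poleOrder, QuantumIndex.rank_add_sum_eq_weight])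
      rwa [hd, add_assoc] at this
    · rw [ProjectiveSpectrum.zeroLocus_union]
      refine Set.inter_subset_inter hsub ?_
      exact (zeroLocus_range_hyperplaneForm L s).subset
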